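/- **Definitions.** Let $M$ be an integer $d\times d$ matrix that is expanding (all its complex eigenvalues have modulus $>1$), and let $D\subset\mathbb Z^d$ be a set of $|\det M|$ digits that are pairwise incongruent modulo $M\mathbb Z^d$. The attractor generated by $M$ and $D$ is $$G(M,D)=\Big\{\sum_{k\ge 1}M^{-k}a_k:\ a_k\in D\Big\}\subset\mathbb R^d .$$ It is a 2-attractor if $|\det M|=2$, and a tile (2-tile) if moreover its Lebesgue measure equals $1$. A 2-attractor is isotropic if it is generated by a matrix $M$ that is similar over $\mathbb R$ to a multiple of an orthogonal matrix. A polynomial is expanding if all its complex roots have modulus $>1$, and isotropic if all its complex roots have the same modulus. The companion matrix of $p(z)=z^d+a_{d-1}z^{d-1}+\dots+a_0$ has ones on the subdiagonal, last column $(-a_0,\dots,-a_{d-1})^T$, and zeros elsewhere. Put $e_1=(1,0,\dots,0)^T\in\mathbb R^d$. Two sets are affinely similar if an invertible affine map of $\mathbb R^d$ takes one onto the other. A function $\varphi$ generates an MRA of $L_2(\mathbb R^d)$ with dilation $M$ if there are closed subspaces $V_j\subset V_{j+1}$, $j\in\mathbb Z$, such that $f\in V_j\Leftrightarrow f(M\,\cdot)\in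 V_{j+1}$, $\overline{\bigcup_j V_j}=L_2(\mathbb R^d)$, $\bigcap_j V_j=\{0\}$, and $\{\varphi(\cdot-k)\}_{k\in\mathbb Z^d}$ is an orthonormal basis of $V_0$. **Theorem.** (1) Let $p$ be a monic integer polynomial of degree $d$ with free term $\pm2$ that is expanding and isotropic, and let $M$ be its companion matrix. Then $M$ and the digits $\{0,e_1\}$ generate a 2-tile $G=G(M,\{0,e_1\})$. Its characteristic function $\varphi=\chi_G$ generates an MRA of $L_2(\mathbb R^d)$ with dilation $M$, and for $\psi(x)=\varphi(Mx)-\varphi(Mx-e_1)$ the Haar system $\{2^{j/2}\psi(M^jx-k)\}_{j\in\mathbb Z,\,k\in\mathbb Z^d}$ is an orthonormal basis of $L_2(\mathbb R^d)$. (2) In particular, every isotropic 2-attractor in $\mathbb R^d$ is affinely similar to a 2-tile that yields an MRA and a Haar basis. Explicitly, if the 2-attractor is generated by an isotropic matrix $N$, then it is affinely similar to $G(M,\{0,e_1\})$, where $M$ is the companion matrix of the characteristic polynomial of $N$; this set is a 2-tile, and it yields an MRA and a Haar basis of $L_2(\mathbb R^d)$ as in (1). -/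

import Mathlib

open MeasureTheory Polynomial

noncomputable section

namespace TwoAttractor

/-- An integer polynomial is expanding if all its complex roots have modulus greater than one. -/
def ExpandingPoly (p : ℤ[X]) : Prop :=
  ∀ z : ℂ, aeval z p = 0 → 1 < ‖z‖

/-- A polynomial is isotropic if all its complex roots have the same modulus. -/
def IsotropicPoly (p : ℤ[X]) : Prop :=
  ∀ z w : ℂ, aeval z p = 0 → aeval w p = 0 → ‖z‖ = ‖w‖

/-- The companion matrix of a monic polynomial `p` of degree `d`: ones on the subdiagonal and
the last column `(-a₀, …, -a_{d-1})`. -/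
def companion (d : ℕ) (p : ℤ[X]) : Matrix (Fin d) (Fin d) ℤ :=
  Matrix.of fun i j =>
    if (j : ℕ) + 1 = d then -p.coeff i
    else if (i : ℕ) = (j : ℕ) + 1 then 1 else 0

/-- The first basis vector `(1, 0, …, 0)`. -/
def e₁ (d : ℕ) : Fin d → ℤ := fun i => if (i : ℕ) = 0 then 1 else 0

/-- An integer matrix viewed as a real matrix. -/
def toReal {d : ℕ} (M : Matrix (Fin d) (Fin d) ℤ) : Matrix (Fin d) (Fin d) ℝ :=
  M.map ((↑) : ℤ → ℝ)

/-- An integer vector viewed as a real vector. -/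
def vecReal {d : ℕ} (a : Fin d → ℤ) : Fin d → ℝ := fun i => (a i : ℝ)

/-- An integer matrix is expanding if all its complex eigenvalues have modulus greater than one. -/
def ExpandingMatrix {d : ℕ} (M : Matrix (Fin d) (Fin d) ℤ) : Prop :=
  ∀ z ∈ spectrum ℂ (M.map ((↑) : ℤ → ℂ)), 1 < ‖z‖

/-- A matrix is isotropic if it is similar to a multiple of an orthogonal matrix. -/
def IsotropicMatrix {d : ℕ} (M : Matrix (Fin d) (Fin d) ℤ) : Prop :=
  ∃ (c : ℝ) (P Q : Matrix (Fin d) (Fin d) ℝ),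
    IsUnit P ∧ Q ∈ Matrix.orthogonalGroup (Fin d) ℝ ∧ toReal M = P * (c • Q) * P⁻¹

/-- The data defining a self-affine attractor: an expanding integer matrix `M` and `|det M|`
integer digits that are pairwise incongruent modulo `M ℤ^d`. -/
structure IsDigitSystem {d : ℕ} (M : Matrix (Fin d) (Fin d) ℤ) (D : Finset (Fin d → ℤ)) :
    Prop where
  expanding : ExpandingMatrix M
  card_eq : D.card = M.det.natAbs
  incongruent : ∀ a ∈ D, ∀ b ∈ D, a ≠ b → ¬ ∃ k : Fin d → ℤ, a - b = M.mulVec k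

/-- The attractor `G(M, D) = { ∑_{k ≥ 1} M^{-k} a_k : a_k ∈ D }`. -/
def attractor {d : ℕ} (M : Matrix (Fin d) (Fin d) ℤ) (D : Finset (Fin d → ℤ)) :
    Set (Fin d → ℝ) :=
  {x | ∃ a : ℕ → (Fin d → ℤ), (∀ k, a k ∈ D) ∧
    HasSum (fun k : ℕ => (((toReal M)⁻¹) ^ (k + 1)).mulVec (vecReal (a k))) x}

/-- `M` and `D` generate a 2-attractor: they define an attractor and `|det M| = 2`. -/
def GeneratesTwoAttractor {d : ℕ} (M : Matrix (Fin d) (Fin d) ℤ) (D : Finset (Fin d → ℤ)) :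
    Prop :=
  IsDigitSystem M D ∧ M.det.natAbs = 2

/-- `M` and `D` generate a 2-tile: a 2-attractor of Lebesgue measure one. -/
def GeneratesTwoTile {d : ℕ} (M : Matrix (Fin d) (Fin d) ℤ) (D : Finset (Fin d → ℤ)) : Prop :=
  GeneratesTwoAttractor M D ∧ volume (attractor M D) = 1

/-- Affine similarity of two sets: one is the image of the other under an invertible affine map. -/
def AffinelySimilar {d : ℕ} (F G : Set (Fin d → ℝ)) : Prop :=
  ∃ E : (Fin d → ℝ) ≃ᵃ[ℝ] (Fin d → ℝ), E '' F = G

/-- The space `L₂(ℝ^d)`. -/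
abbrev L2 (d : ℕ) : Type := Lp ℂ 2 (volume : Measure (Fin d → ℝ))

/-- The characteristic function of a set. -/
def chi {d : ℕ} (G : Set (Fin d → ℝ)) : (Fin d → ℝ) → ℂ := G.indicator fun _ => 1

/-- `(V j)` is a multiresolution analysis of `L₂(ℝ^d)` with dilation matrix `A` and scaling
function `φ`. -/
structure IsMRA {d : ℕ} (A : Matrix (Fin d) (Fin d) ℝ) (φ : (Fin d → ℝ) → ℂ)
    (V : ℤ → Submodule ℂ (L2 d)) : Prop where
  closed : ∀ j, IsClosed (V j : Set (L2 d))
  nested : ∀ j, V j ≤ V (j + 1)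
  /-- `f ∈ V_j` if and only if `f(A ·) ∈ V_{j+1}`. -/
  dilation : ∀ (j : ℤ) (f g : L2 d), (g =ᵐ[volume] fun x => f (A.mulVec x)) →
    (f ∈ V j ↔ g ∈ V (j + 1))
  dense : (⨆ j, V j).topologicalClosure = ⊤
  separated : ⨅ j, V j = ⊥
  /-- The integer shifts of `φ` are an orthonormal basis of `V₀`. -/
  shifts : ∃ u : (Fin d → ℤ) → L2 d,
    (∀ k, u k =ᵐ[volume] fun x => φ (x - vecReal k)) ∧
    Orthonormal ℂ u ∧ (Submodule.span ℂ (Set.range u)).topologicalClosure = V 0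

/-- `φ` generates a multiresolution analysis of `L₂(ℝ^d)` with dilation matrix `A`. -/
def GeneratesMRA {d : ℕ} (A : Matrix (Fin d) (Fin d) ℝ) (φ : (Fin d → ℝ) → ℂ) : Prop :=
  ∃ V : ℤ → Submodule ℂ (L2 d), IsMRA A φ V

/-- `|det A|^{j/2} ψ(A^j x - k)`, `j ∈ ℤ`, `k ∈ ℤ^d`, is an orthonormal basis of `L₂(ℝ^d)`. -/
def GeneratesWaveletBasis {d : ℕ} (A : Matrix (Fin d) (Fin d) ℝ) (ψ : (Fin d → ℝ) → ℂ) : Prop :=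
  ∃ b : HilbertBasis (ℤ × (Fin d → ℤ)) ℂ (L2 d), ∀ (j : ℤ) (k : Fin d → ℤ),
    b (j, k) =ᵐ[volume] fun x =>
      (((Real.sqrt |A.det|) ^ j : ℝ) : ℂ) * ψ ((A ^ j).mulVec x - vecReal k)

/-- The Haar function `ψ(x) = φ(M x) - φ(M x - a)` of `G(M, {0, a})`, where `φ` is the
characteristic function of `G(M, {0, a})`. -/
def haar {d : ℕ} (M : Matrix (Fin d) (Fin d) ℤ) (a : Fin d → ℤ) : (Fin d → ℝ) → ℂ :=
  fun x => chi (attractor M {0, a}) ((toReal M).mulVec x) -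
    chi (attractor M {0, a}) ((toReal M).mulVec x - vecReal a)

end TwoAttractor

end

noncomputable section

namespace TwoAttractor

/-! Write `G` for the attractor of `M` and `{0, e}`, so that `M G = G ∪ (G + e)`. When `{0, e}` is a
complete residue system modulo `M ℤ^d`, the integer translates of `G` cover the space. Since `|det
M| = 2`, comparing volumes makes `G ∩ (G + e)` null. If `G ∩ (G + k)` is null, so is its image under
`M`, which contains `G ∩ (G + M k)`, `G ∩ (G + M k + e)` and `(G + e) ∩ (G + M k)`. Nullity thus
passes from `k` to `M k` and `M k ± e`, and `G` is a tile as soon as these moves lead from `0` to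
every integer vector; `IsTernaryDigit` records this criterion.

For a companion matrix, `ℤ^d` is `ℤ[X]/(p)`, with `e₁` the class of `1` and `M` multiplication by
`X`. The criterion then asks that every class modulo `p` contain a polynomial with coefficients in
`{-1, 0, 1}`. Isotropy leaves few `p` (`isotropic_classification`): conjugation acts on the roots as
`z ↦ r / z`, which ties the coefficient of degree `j` to that of degree `d - j`, and 2-adic
valuations then allow a nonzero inner coefficient only in degree `d / 2`. Hence `p = q(X^k)` with
`q` linear or quadratic. Ternary representatives modulo `q` come from a descent on an absolute value
or a norm form, and they lift to `q(X^k)`.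

The cells `M^{-j}(G + k)` split in two at each level, a structure abstracted in `IsRefinable`.
Differences of halves are orthogonal. They are total because a function orthogonal to all of them
has an integral that doubles from each cell to its parent, while Cauchy-Schwarz permits growth only
by `√2`.

In part (2) the characteristic polynomial of `N` is irreducible, so the difference of the two digits
is a cyclic vector. Its Krylov matrix conjugates the companion matrix into `N` and carries one
attractor to a translate of the other. -/

/-! ### Representatives with coefficients in `{-1, 0, 1}` modulo a polynomial -/

/-- `f` is congruent modulo `q` to a polynomial with coefficients in `{-1, 0, 1}`. -/
def TernaryMod (q f : ℤ[X]) : Prop :=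
  ∃ g : ℤ[X], (∀ i, g.coeff i = -1 ∨ g.coeff i = 0 ∨ g.coeff i = 1) ∧ q ∣ f - g

lemma TernaryMod.of_coeff {q f : ℤ[X]}
    (h : ∀ i, f.coeff i = -1 ∨ f.coeff i = 0 ∨ f.coeff i = 1) : TernaryMod q f :=
  ⟨f, h, by simp⟩

lemma TernaryMod.congr {q f f' : ℤ[X]} (h : TernaryMod q f') (hd : q ∣ f - f') :
    TernaryMod q f := by
  obtain ⟨g, hg, hq⟩ := h
  exact ⟨g, hg, by simpa using dvd_add hd hq⟩

lemma TernaryMod.cons {q f' : ℤ[X]} (h : TernaryMod q f') {ε : ℤ}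
    (hε : ε = -1 ∨ ε = 0 ∨ ε = 1) : TernaryMod q (C ε + X * f') := by
  obtain ⟨g, hg, hq⟩ := h
  refine ⟨C ε + X * g, fun i => ?_, ?_⟩
  · cases i with
    | zero => simpa using hε
    | succ i => simpa [coeff_C, -eq_intCast] using hg i
  · have : C ε + X * f' - (C ε + X * g) = X * (f' - g) := by ring
    rw [this]
    exact dvd_mul_of_dvd_right hq X

/-- Since `X ≡ -c`, only constants matter. A constant `m = ε - c t` is congruent to `ε + X t`, and
`|t| < |m|` unless `m = 0`: this is signed expansion in base `±2`. -/
lemma ternaryMod_X_add_C {c : ℤ} (hc : c = 2 ∨ c = -2) (f : ℤ[X]) :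
    TernaryMod (X + C c) f := by
  have key : ∀ (n : ℕ) (m : ℤ), m.natAbs = n → TernaryMod (X + C c) (C m) := by
    intro n
    induction n using Nat.strong_induction_on with
    | _ n ih =>
      intro m hm
      have hex : ∃ ε t : ℤ, (ε = -1 ∨ ε = 0 ∨ ε = 1) ∧ m = ε - c * t ∧
          (t.natAbs < m.natAbs ∨ m = 0) := by
        rcases hc with rfl | rfl
        · rcases le_total 0 m with h | h
          · exact ⟨m % 2, -(m / 2), by omega, by omega, by omega⟩
          · exact ⟨-((-m) % 2), (-m) / 2, by omega, by omega, by omega⟩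
        · rcases le_total 0 m with h | h
          · exact ⟨m % 2, m / 2, by omega, by omega, by omega⟩
          · exact ⟨-((-m) % 2), -((-m) / 2), by omega, by omega, by omega⟩
      obtain ⟨ε, t, hε, hmt, hlt⟩ := hex
      rcases hlt with hlt | rfl
      · refine ((ih t.natAbs (hm ▸ hlt) t rfl).cons hε).congr ⟨-C t, ?_⟩
        rw [hmt]; simp only [C_sub, C_mul]; ring
      · exact TernaryMod.of_coeff fun i => by simp
  have hq : X + C c = X - C (-c) := by simp
  refine (key _ (f.eval (-c)) rfl).congr ?_
  rw [hq]
  exact X_sub_C_dvd_sub_C_eval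

/-- For a root `θ`, the form `u² - a u v + 2 v²` is the norm of `u + v θ`. Subtracting a digit of
the parity of `u` makes this element divisible by `θ`, and division by `θ` halves the norm. -/
lemma ternaryMod_quadratic {a : ℤ} (ha : |a| ≤ 2) (f : ℤ[X]) :
    TernaryMod (X ^ 2 + C a * X + C 2) f := by
  obtain ⟨ha1, ha2⟩ := abs_le.1 ha
  have hN : ∀ u v : ℤ, 0 ≤ u ^ 2 - a * u * v + 2 * v ^ 2 := fun u v => by
    have h1 : (4 : ℤ) * (u ^ 2 - a * u * v + 2 * v ^ 2)
        = (2 * u - a * v) ^ 2 + (8 - a ^ 2) * v ^ 2 := by ring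
    have h2 : 0 ≤ 8 - a ^ 2 := by nlinarith
    nlinarith [sq_nonneg (2 * u - a * v), mul_nonneg h2 (sq_nonneg v)]
  have key : ∀ (n : ℕ) (u v : ℤ), u ^ 2 - a * u * v + 2 * v ^ 2 = n →
      TernaryMod (X ^ 2 + C a * X + C 2) (C v * X + C u) := by
    intro n
    induction n using Nat.strong_induction_on with
    | _ n ih =>
      intro u v hn
      by_cases hsmall : (u = -1 ∨ u = 0 ∨ u = 1) ∧ (v = -1 ∨ v = 0 ∨ v = 1)
      · refine TernaryMod.of_coeff fun i => ?_
        match i with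
        | 0 => simpa using hsmall.1
        | 1 => simpa [coeff_C, -eq_intCast] using hsmall.2
        | i + 2 => right; left; simp [-eq_intCast]
      -- An odd `u` gets the digit with the sign of `2 u - a v`, so removing it raises the norm by
      -- at most `1`. Outside the ternary square the norm is at least `2`, so it drops after
      -- halving.
      have hex : ∃ ε t : ℤ, (ε = -1 ∨ ε = 0 ∨ ε = 1) ∧ u = ε + 2 * t ∧
          n + ε ^ 2 - ε * (2 * u - a * v) < 2 * n := by
        have h1 : (4 : ℤ) * n = (2 * u - a * v) ^ 2 + (8 - a ^ 2) * v ^ 2 := by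
          rw [← hn]; ring
        have h2 : 4 ≤ 8 - a ^ 2 := by nlinarith
        have hbig : (2 : ℤ) ≤ n ∨ (0 < |2 * u - a * v| ∧ (n : ℤ) = 1) := by
          by_contra hcon
          push Not at hcon
          obtain ⟨hn1, hT⟩ := hcon
          have hv : v ^ 2 ≤ 1 := by
            nlinarith [sq_nonneg (2 * u - a * v), mul_nonneg (sub_nonneg.2 h2) (sq_nonneg v)]
          have hv1 : -1 ≤ v := by nlinarith
          have hv2 : v ≤ 1 := by nlinarith
          have hu : u ^ 2 ≤ 3 := by
            nlinarith [sq_nonneg (u - a * v), sq_nonneg (u - 2 * a * v)]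
          have hu1 : -1 ≤ u := by nlinarith
          have hu2 : u ≤ 1 := by nlinarith
          exact hsmall ⟨by omega, by omega⟩
        have hn0 : (1 : ℤ) ≤ n := by rcases hbig with h | h <;> omega
        rcases Int.even_or_odd' u with ⟨t, ht | ht⟩
        · exact ⟨0, t, by simp, by omega, by omega⟩
        · rcases le_total 0 (2 * u - a * v) with h | h
          · refine ⟨1, t, by simp, by omega, ?_⟩
            rcases hbig with hb | ⟨hb, hb'⟩
            · omega
            · rw [abs_of_nonneg h] at hb; omega
          · refine ⟨-1, t + 1, by simp, by omega, ?_⟩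
            rcases hbig with hb | ⟨hb, hb'⟩
            · omega
            · rw [abs_of_nonpos h] at hb; omega
      obtain ⟨ε, t, hε, hut, hlt⟩ := hex
      have hN' : 2 * ((v - a * t) ^ 2 - a * (v - a * t) * (-t) + 2 * (-t) ^ 2)
          = n + ε ^ 2 - ε * (2 * u - a * v) := by
        rw [← hn, hut]; ring
      obtain ⟨n', hn'⟩ := Int.eq_ofNat_of_zero_le (hN (v - a * t) (-t))
      -- With `u = ε + 2 t` and `2 = θ (-θ - a)`, one has `u + v θ = ε + θ ((v - a t) - t θ)`.
      refine ((ih n' (by omega) _ _ hn').cons hε).congr ⟨C t, ?_⟩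
      rw [hut]
      simp only [C_add, C_mul, C_sub, C_neg]
      rw [show (C (2 : ℤ) : ℤ[X]) = 2 from rfl]
      ring
  have hm : (X ^ 2 + C a * X + C 2 : ℤ[X]).Monic := by monicity!
  have hdeg : (X ^ 2 + C a * X + C 2 : ℤ[X]).natDegree = 2 := by compute_degree!
  have hr : (f %ₘ (X ^ 2 + C a * X + C 2)).natDegree ≤ 1 := by
    have := natDegree_modByMonic_lt f hm (by intro h; rw [h] at hdeg; simp at hdeg)
    omega
  obtain ⟨v, u, huv⟩ := exists_eq_X_add_C_of_natDegree_le_one hr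
  obtain ⟨n, hn⟩ := Int.eq_ofNat_of_zero_le (hN u v)
  refine (key n u v hn).congr ?_
  rw [← huv]
  exact ⟨f /ₘ (X ^ 2 + C a * X + C 2), by
    rw [sub_eq_iff_eq_add, add_comm]; exact (modByMonic_add_div f _).symm⟩

lemma exists_sum_expand {k : ℕ} (hk : 0 < k) (f : ℤ[X]) :
    ∃ F : ℕ → ℤ[X], f = ∑ i ∈ Finset.range k, X ^ i * expand ℤ k (F i) := by
  induction f using Polynomial.induction_on' with
  | add f g hf hg =>
    obtain ⟨F, hF⟩ := hf
    obtain ⟨G, hG⟩ := hg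
    exact ⟨F + G, by rw [hF, hG, ← Finset.sum_add_distrib]; simp [mul_add]⟩
  | monomial n a =>
    refine ⟨fun i => if i = n % k then monomial (n / k) a else 0, ?_⟩
    rw [Finset.sum_eq_single (n % k)]
    · simp only [if_true]
      rw [expand_monomial, X_pow_mul_monomial]
      congr 2
      rw [mul_comm, Nat.div_add_mod]
    · intro b _ hb; simp [hb]
    · intro h; exact absurd (Finset.mem_range.2 (Nat.mod_lt n hk)) h

/-- Sort the monomials by exponent modulo `k` and reduce each class modulo `q` in the variable
`X^k`. The classes occupy disjoint sets of exponents, so their ternary coefficients never add up. -/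
lemma ternaryMod_expand {k : ℕ} (hk : 0 < k) {q : ℤ[X]} (hq : ∀ f, TernaryMod q f) (f : ℤ[X]) :
    TernaryMod (expand ℤ k q) f := by
  obtain ⟨F, rfl⟩ := exists_sum_expand hk f
  choose G hG hd using fun i => hq (F i)
  refine ⟨∑ i ∈ Finset.range k, X ^ i * expand ℤ k (G i), fun m => ?_, ?_⟩
  · have : (∑ i ∈ Finset.range k, X ^ i * expand ℤ k (G i)).coeff m
        = (G (m % k)).coeff (m / k) := by
      rw [finsetSum_coeff, Finset.sum_eq_single (m % k)]
      · rw [coeff_X_pow_mul', if_pos (Nat.mod_le m k), coeff_expand hk]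
        rw [if_pos (Nat.dvd_sub_mod m)]
        congr 1
        rw [← Nat.div_eq_sub_mod_div]
      · intro b hb hbm
        rw [coeff_X_pow_mul']
        split_ifs with hle
        · rw [coeff_expand hk, if_neg]
          intro hdvd
          apply hbm
          have := (Nat.modEq_iff_dvd' hle).2 hdvd
          rw [← Nat.mod_eq_of_lt (Finset.mem_range.1 hb)]
          exact this
        · rfl
      · intro h; exact absurd (Finset.mem_range.2 (Nat.mod_lt m hk)) h
    rw [this]; exact hG _ _
  · rw [← Finset.sum_sub_distrib]
    refine Finset.dvd_sum fun i _ => ?_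
    rw [← mul_sub, ← map_sub]
    exact dvd_mul_of_dvd_right (map_dvd (expand ℤ k) (hd i)) _

/-! ### Expanding and isotropic polynomials with free term `±2` -/

lemma one_lt_multiset_prod (s : Multiset ℝ) (hs : ∀ x ∈ s, 1 < x) :
    1 ≤ s.prod ∧ (s ≠ 0 → 1 < s.prod) := by
  induction s using Multiset.induction_on with
  | empty => simp
  | cons a s ih =>
    have h1 := (ih fun x hx => hs x (Multiset.mem_cons_of_mem hx)).1
    have h2 := hs a (Multiset.mem_cons_self a s)
    have : 1 < (a ::ₘ s).prod := by rw [Multiset.prod_cons]; nlinarith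
    exact ⟨this.le, fun _ => this⟩

lemma abs_coeff_zero_eq_prod_norm {p : ℤ[X]} (hp : p.Monic) :
    |(p.coeff 0 : ℝ)| = ((p.map (algebraMap ℤ ℂ)).roots.map norm).prod := by
  have h := (IsAlgClosed.splits (p.map (algebraMap ℤ ℂ))).coeff_zero_eq_prod_roots_of_monic
    (hp.map _)
  have h2 := congrArg norm h
  rw [norm_mul, norm_pow, norm_neg, norm_one, one_pow, one_mul, coeff_map] at h2
  have h3 := map_multiset_prod (normHom : ℂ →*₀ ℝ) (p.map (algebraMap ℤ ℂ)).roots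
  simp only [normHom_apply] at h3
  rw [← h3]
  simpa using h2

lemma mem_roots_map_iff {p : ℤ[X]} (hp : p.Monic) {z : ℂ} :
    z ∈ (p.map (algebraMap ℤ ℂ)).roots ↔ aeval z p = 0 := by
  rw [mem_roots (hp.map _).ne_zero, IsRoot.def, eval_map_algebraMap]

lemma card_roots_map {p : ℤ[X]} (hp : p.Monic) :
    (p.map (algebraMap ℤ ℂ)).roots.card = p.natDegree := by
  rw [← (IsAlgClosed.splits (p.map (algebraMap ℤ ℂ))).natDegree_eq_card_roots,
    hp.natDegree_map]

lemma ExpandingPoly.one_lt_abs_coeff_zero {p : ℤ[X]} (hp : p.Monic) (he : ExpandingPoly p)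
    (hd : p.natDegree ≠ 0) : 1 < |p.coeff 0| := by
  have h : (1 : ℝ) < |(p.coeff 0 : ℝ)| := by
    rw [abs_coeff_zero_eq_prod_norm hp]
    refine (one_lt_multiset_prod _ fun x hx => ?_).2 fun h0 => hd ?_
    · obtain ⟨z, hz, rfl⟩ := Multiset.mem_map.1 hx
      exact he z ((mem_roots_map_iff hp).1 hz)
    · rw [← card_roots_map hp, ← Multiset.card_map norm, h0, Multiset.card_zero]
  exact_mod_cast h

/-- Factors of an expanding polynomial are expanding, so two nonconstant monic ones would have free
terms of modulus at least `2`, with product of modulus at least `4`. -/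
lemma ExpandingPoly.irreducible {p : ℤ[X]} (hp : p.Monic) (he : ExpandingPoly p)
    (h0 : p.coeff 0 = 2 ∨ p.coeff 0 = -2) : Irreducible p := by
  refine hp.irreducible_iff_natDegree.2 ⟨fun h => by simp [h] at h0, fun f g hf hg hfg => ?_⟩
  by_contra hcon
  push Not at hcon
  have h1 := ExpandingPoly.one_lt_abs_coeff_zero hf
    (fun z hz => he z (by rw [← hfg, map_mul, hz, zero_mul])) hcon.1
  have h2 := ExpandingPoly.one_lt_abs_coeff_zero hg
    (fun z hz => he z (by rw [← hfg, map_mul, hz, mul_zero])) hcon.2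
  have h3 : |f.coeff 0| * |g.coeff 0| = 2 := by
    rw [← abs_mul, ← mul_coeff_zero, hfg]
    rcases h0 with h | h <;> rw [h] <;> rfl
  nlinarith

lemma natDegree_pos_of_coeff_zero {p : ℤ[X]} (hp : p.Monic)
    (h0 : p.coeff 0 = 2 ∨ p.coeff 0 = -2) : 0 < p.natDegree := by
  rw [Nat.pos_iff_ne_zero]
  intro h
  rw [hp.natDegree_eq_zero.1 h] at h0
  simp at h0

/-- Irreducibility over `ℚ` gives separability, hence as many distinct roots as the degree; these
serve as interpolation points for identifying coefficients. -/
lemma exists_finset_roots {p : ℤ[X]} (hp : p.Monic) (hirr : Irreducible p) :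
    ∃ s : Finset ℂ, s.card = p.natDegree ∧ ∀ z ∈ s, aeval z p = 0 := by
  have hq : (p.map (algebraMap ℤ ℚ)).Separable :=
    ((hp.irreducible_iff_irreducible_map_fraction_map (K := ℚ)).1 hirr).separable
  have hc : p.map (algebraMap ℤ ℂ) = (p.map (algebraMap ℤ ℚ)).map (algebraMap ℚ ℂ) := by
    rw [Polynomial.map_map]; congr 1
  have hnd : (p.map (algebraMap ℤ ℂ)).roots.Nodup := by
    rw [hc]; exact nodup_roots (hq.map)
  refine ⟨(p.map (algebraMap ℤ ℂ)).roots.toFinset, ?_, fun z hz => ?_⟩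
  · rw [Multiset.toFinset_card_of_nodup hnd, card_roots_map hp]
  · exact (mem_roots_map_iff hp).1 (Multiset.mem_toFinset.1 hz)

/-- The coefficients of an irreducible isotropic polynomial satisfy a reflection identity. -/
lemma isotropic_reflection {p : ℤ[X]} (hp : p.Monic) (hirr : Irreducible p)
    (h0 : p.coeff 0 = 2 ∨ p.coeff 0 = -2) (hiso : IsotropicPoly p) :
    ∃ r : ℝ, 0 < r ∧ r ^ p.natDegree = 4 ∧ (∀ z : ℂ, aeval z p = 0 → ‖z‖ ^ 2 = r) ∧
      ∀ j ≤ p.natDegree, (p.coeff j : ℝ) * r ^ j = p.coeff 0 * p.coeff (p.natDegree - j) := by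
  set d := p.natDegree with hd
  have hdpos : 0 < d := natDegree_pos_of_coeff_zero hp h0
  have hnz : ∀ z : ℂ, aeval z p = 0 → z ≠ 0 := by
    rintro z hz rfl
    have : ((p.coeff 0 : ℤ) : ℂ) = 0 := by
      have := hz
      rw [aeval_def, eval₂_at_zero] at this
      simpa using this
    rcases h0 with h | h <;> rw [h] at this <;> norm_num at this
  obtain ⟨s, hs, hsr⟩ := exists_finset_roots hp hirr
  obtain ⟨z₀, hz₀⟩ : s.Nonempty := by rw [← Finset.card_pos, hs]; exact hdpos
  have hz₀r := hsr z₀ hz₀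
  have hr : ∀ z : ℂ, aeval z p = 0 → ‖z‖ ^ 2 = ‖z₀‖ ^ 2 := fun z hz => by rw [hiso z z₀ hz hz₀r]
  have hrpos : 0 < ‖z₀‖ ^ 2 := by have := norm_pos_iff.2 (hnz z₀ hz₀r); positivity
  refine ⟨‖z₀‖ ^ 2, hrpos, ?_, hr, ?_⟩
  · have h := abs_coeff_zero_eq_prod_norm hp
    have hrep : (p.map (algebraMap ℤ ℂ)).roots.map norm = Multiset.replicate d ‖z₀‖ := by
      rw [Multiset.eq_replicate]
      refine ⟨by rw [Multiset.card_map, card_roots_map hp], fun x hx => ?_⟩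
      obtain ⟨z, hz, rfl⟩ := Multiset.mem_map.1 hx
      exact hiso z z₀ ((mem_roots_map_iff hp).1 hz) hz₀r
    rw [hrep, Multiset.prod_replicate] at h
    rw [← pow_mul, mul_comm, pow_mul, ← h]
    rcases h0 with h | h <;> rw [h] <;> norm_num
  · set r : ℝ := ‖z₀‖ ^ 2
    -- This is `z^d p(r / z) - p(0) p(z)`. Both terms vanish at each root `z`, as `r / z` is its
    -- conjugate. The coefficients of degree `d` cancel, so `Q` has degree below `d` and `d`
    -- distinct zeros.
    set Q : ℂ[X] := ∑ j ∈ Finset.range (d + 1),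
      monomial (d - j) ((p.coeff j : ℂ) * (r : ℂ) ^ j - p.coeff 0 * p.coeff (d - j)) with hQ
    have hcoeff : ∀ j ≤ d, Q.coeff (d - j)
        = (p.coeff j : ℂ) * (r : ℂ) ^ j - p.coeff 0 * p.coeff (d - j) := fun j hj => by
      rw [hQ, finsetSum_coeff, Finset.sum_eq_single j]
      · simp
      · intro b hb hbj
        rw [coeff_monomial, if_neg]
        have := Finset.mem_range.1 hb
        omega
      · intro h; exact absurd (Finset.mem_range.2 (by omega)) h
    have hdeg : Q.degree < s.card := by
      rw [hs, degree_lt_iff_coeff_zero]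
      intro m hm
      rcases hm.eq_or_lt with rfl | hlt
      · have := hcoeff 0 (Nat.zero_le _)
        rw [Nat.sub_zero] at this
        rw [← hd, this, hd, hp.coeff_natDegree]
        simp
      · rw [hQ, finsetSum_coeff]
        refine Finset.sum_eq_zero fun b _ => ?_
        rw [coeff_monomial, if_neg]
        omega
    have hQ0 : Q = 0 := by
      refine eq_zero_of_degree_lt_of_eval_finset_eq_zero s hdeg fun z hz => ?_
      have hz0 := hsr z hz
      have hzn := hnz z hz0
      have hconj : aeval (starRingEnd ℂ z) p = 0 := by
        have h2 := congrArg (starRingEnd ℂ) hz0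
        rw [map_zero, aeval_eq_sum_range, map_sum] at h2
        rw [aeval_eq_sum_range, ← h2]
        exact Finset.sum_congr rfl fun i _ => by simp
      have hzr : starRingEnd ℂ z = r / z := by
        rw [eq_div_iff hzn, mul_comm, Complex.mul_conj, Complex.normSq_eq_norm_sq, hr z hz0]
      have e1 : ∑ j ∈ Finset.range (d + 1), (p.coeff j : ℂ) * (r : ℂ) ^ j * z ^ (d - j) = 0 := by
        rw [hzr, aeval_eq_sum_range] at hconj
        have h3 := congrArg (fun x => x * z ^ d) hconj
        simp only [zero_mul, Finset.sum_mul] at h3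
        rw [← h3]
        refine Finset.sum_congr rfl fun j hj => ?_
        have hj' : j ≤ d := by have := Finset.mem_range.1 hj; omega
        rw [zsmul_eq_mul, div_pow, ← Nat.sub_add_cancel hj', pow_add, Nat.add_sub_cancel]
        field_simp
      have e2 : ∑ j ∈ Finset.range (d + 1), (p.coeff (d - j) : ℂ) * z ^ (d - j) = 0 := by
        rw [aeval_eq_sum_range] at hz0
        rw [← hz0, ← Finset.sum_range_reflect]
        refine Finset.sum_congr rfl fun j hj => ?_
        have hj' : p.natDegree - (p.natDegree - j) = j := by
          have := Finset.mem_range.1 hj; omega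
        simp [hd, hj']
      rw [hQ, eval_finsetSum]
      have : ∀ j ∈ Finset.range (d + 1), eval z (monomial (d - j)
          ((p.coeff j : ℂ) * (r : ℂ) ^ j - p.coeff 0 * p.coeff (d - j)))
          = (p.coeff j : ℂ) * (r : ℂ) ^ j * z ^ (d - j)
            - p.coeff 0 * ((p.coeff (d - j) : ℂ) * z ^ (d - j)) := fun j _ => by
        rw [eval_monomial]; ring
      rw [Finset.sum_congr rfl this, Finset.sum_sub_distrib, ← Finset.mul_sum, e1, e2]
      simp
    intro j hj
    have := hcoeff j hj
    rw [hQ0, coeff_zero, eq_comm, sub_eq_zero] at this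
    exact_mod_cast this

/-- Isotropic expanding polynomials with free term `±2` have at most one middle coefficient. -/
lemma isotropic_classification {p : ℤ[X]} (hp : p.Monic) (he : ExpandingPoly p)
    (h0 : p.coeff 0 = 2 ∨ p.coeff 0 = -2) (hiso : IsotropicPoly p) :
    (∃ k, 0 < k ∧ p = expand ℤ k (X + C (p.coeff 0))) ∨
      ∃ k a, 0 < k ∧ |a| ≤ 2 ∧ p = expand ℤ k (X ^ 2 + C a * X + C 2) := by
  have hirr := ExpandingPoly.irreducible hp he h0
  obtain ⟨r, hr0, hrd, hrz, hrefl⟩ := isotropic_reflection hp hirr h0 hiso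
  have hd := natDegree_pos_of_coeff_zero hp h0
  set d := p.natDegree with hdd
  -- The `d`-th power of the reflection identity is an identity of integers because `r^d = 4`.
  -- Comparing 2-adic valuations modulo `d` gives `d ∣ 2 j`.
  have hmid : ∀ j, 0 < j → j < d → p.coeff j ≠ 0 → 2 * j = d := by
    intro j hj hjd hne
    have h1 := congrArg (fun x => x ^ d) (hrefl j hjd.le)
    simp only [mul_pow] at h1
    rw [← pow_mul, mul_comm j d, pow_mul, hrd] at h1
    have h2 : p.coeff j ^ d * 4 ^ j = p.coeff 0 ^ d * p.coeff (d - j) ^ d := by exact_mod_cast h1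
    have h2' := congrArg Int.natAbs h2
    simp only [Int.natAbs_mul, Int.natAbs_pow] at h2'
    have h00 : (p.coeff 0).natAbs = 2 := by rcases h0 with h | h <;> rw [h] <;> rfl
    rw [h00, show Int.natAbs 4 = 2 ^ 2 from rfl, ← pow_mul] at h2'
    have hA : (p.coeff j).natAbs ≠ 0 := Int.natAbs_ne_zero.2 hne
    have hB : (p.coeff (d - j)).natAbs ≠ 0 := by
      intro h
      rw [h, zero_pow hd.ne', mul_zero] at h2'
      have : 0 < (p.coeff j).natAbs ^ d * 2 ^ (2 * j) := by positivity
      omega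
    have h3 := congrArg (padicValNat 2) h2'
    rw [padicValNat.mul (pow_ne_zero _ hA) (by positivity),
      padicValNat.mul (by positivity) (pow_ne_zero _ hB), padicValNat.pow,
      padicValNat.pow, padicValNat.prime_pow, padicValNat.pow, padicValNat.self one_lt_two,
      mul_one] at h3
    have h4 : d ∣ 2 * j := by
      rw [← Nat.dvd_add_right (Dvd.intro (padicValNat 2 (p.coeff j).natAbs) rfl), h3,
        Nat.dvd_add_right (dvd_refl d)]
      exact Dvd.intro _ rfl
    obtain ⟨c, hc⟩ := h4
    have : c < 2 := by
      by_contra hcon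
      push Not at hcon
      nlinarith
    interval_cases c <;> omega
  by_cases hex : ∃ j, 0 < j ∧ j < d ∧ p.coeff j ≠ 0
  · obtain ⟨k, hk, hkd, hne⟩ := hex
    have h2k := hmid k hk hkd hne
    right
    have hrk : r ^ k = 2 := by
      have h4 : (r ^ k) ^ 2 = 2 ^ 2 := by rw [← pow_mul, mul_comm, h2k, hrd]; norm_num
      exact (pow_left_inj₀ (by positivity) (by norm_num) two_ne_zero).1 h4
    -- The middle coefficient is its own mirror image, so the reflection identity forces `p(0) =
    -- r^k`.
    have h02 : p.coeff 0 = 2 := by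
      have h5 := hrefl k hkd.le
      rw [hrk, show d - k = k by omega, mul_comm] at h5
      have h6 : (2 : ℤ) * p.coeff k = p.coeff 0 * p.coeff k := by exact_mod_cast h5
      exact (mul_right_cancel₀ hne h6).symm
    have hform : p = expand ℤ k (X ^ 2 + C (p.coeff k) * X + C 2) := by
      ext i
      simp only [map_add, map_mul, map_pow, expand_X, expand_C, ← pow_mul, coeff_add, coeff_C_mul,
        coeff_X_pow, coeff_C]
      rcases Nat.eq_zero_or_pos i with rfl | hi
      · rw [h02, if_neg (by omega), if_neg (by omega), if_pos rfl]; ring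
      · rcases lt_trichotomy i d with h | h | h
        · by_cases hik : i = k
          · subst hik
            rw [if_neg (by omega), if_pos rfl, if_neg (by omega)]; ring
          · rw [if_neg (by omega), if_neg hik, if_neg (by omega)]
            by_contra hcon
            have := hmid i hi h (by simpa using hcon)
            omega
        · rw [h, if_pos (by omega), if_neg (by omega), if_neg (by omega), hdd, hp.coeff_natDegree]
          ring
        · rw [if_neg (by omega), if_neg (by omega), if_neg (by omega),
            coeff_eq_zero_of_natDegree_lt h]; ring
    refine ⟨k, p.coeff k, hk, ?_, hform⟩
    obtain ⟨s, hs, hsr⟩ := exists_finset_roots hp hirr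
    obtain ⟨z, hz⟩ : s.Nonempty := by rw [← Finset.card_pos, hs]; exact hd
    have hz0 := hsr z hz
    have hnz : (‖z‖ ^ k) ^ 2 = 2 := by rw [← pow_mul, mul_comm, pow_mul, hrz z hz0, hrk]
    rw [hform, expand_aeval] at hz0
    simp only [map_add, map_mul, map_pow, aeval_X, aeval_C] at hz0
    set w := z ^ k with hw
    have hnw : ‖w‖ ^ 2 = 2 := by rw [hw, norm_pow, hnz]
    have h7 : |(p.coeff k : ℝ)| * ‖w‖ ≤ 4 := by
      have h8 : (p.coeff k : ℂ) * w = -(w ^ 2 + 2) := by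
        rw [eq_neg_iff_add_eq_zero, ← hz0]; simp; ring
      have h9 := congrArg norm h8
      rw [norm_mul, norm_neg, Complex.norm_intCast] at h9
      rw [h9]
      refine (norm_add_le _ _).trans ?_
      rw [norm_pow, hnw]; norm_num
    -- From `|a| √2 ≤ 4`; the rational bound `1.4 < √2` already gives `|a| < 3`.
    have h10 : |(p.coeff k : ℝ)| < 3 := by
      have : (1.4 : ℝ) < ‖w‖ := by nlinarith [norm_nonneg w]
      nlinarith [abs_nonneg (p.coeff k : ℝ)]
    have h11 : |p.coeff k| < 3 := by exact_mod_cast h10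
    omega
  · push Not at hex
    left
    refine ⟨d, hd, ?_⟩
    ext i
    simp only [map_add, expand_X, expand_C, coeff_add, coeff_X_pow, coeff_C]
    rcases Nat.eq_zero_or_pos i with rfl | hi
    · rw [if_neg (by omega), if_pos rfl]; ring
    · rcases lt_trichotomy i d with h | h | h
      · rw [if_neg (by omega), if_neg (by omega), hex i hi h]; ring
      · rw [h, if_pos rfl, if_neg (by omega), hdd, hp.coeff_natDegree]; ring
      · rw [if_neg (by omega), if_neg (by omega), coeff_eq_zero_of_natDegree_lt h]; ring

lemma ternaryMod_of_isotropic {p : ℤ[X]} (hp : p.Monic) (he : ExpandingPoly p)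
    (h0 : p.coeff 0 = 2 ∨ p.coeff 0 = -2) (hiso : IsotropicPoly p) (f : ℤ[X]) :
    TernaryMod p f := by
  rcases isotropic_classification hp he h0 hiso with ⟨k, hk, h⟩ | ⟨k, a, hk, ha, h⟩
  · rw [h]; exact ternaryMod_expand hk (ternaryMod_X_add_C h0) f
  · rw [h]; exact ternaryMod_expand hk (ternaryMod_quadratic ha) f

/-! ### Ternary digits and companion matrices -/

/-- An expanding integer matrix of determinant `±2` with the residue system `{0, e}`, for which
every integer vector has a finite expansion with digits in `{-e, 0, e}`. -/
structure IsTernaryDigit {d : ℕ} (M : Matrix (Fin d) (Fin d) ℤ) (e : Fin d → ℤ) : Prop where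
  expanding : ExpandingMatrix M
  det_natAbs : M.det.natAbs = 2
  not_mem : ∀ t, e ≠ M.mulVec t
  exists_residue : ∀ k, ∃ t, k = M.mulVec t ∨ k = M.mulVec t + e
  induction : ∀ S : Set (Fin d → ℤ), 0 ∈ S →
    (∀ k ∈ S, M.mulVec k ∈ S ∧ M.mulVec k + e ∈ S ∧ M.mulVec k - e ∈ S) → ∀ k, k ∈ S

section Companion

variable {d : ℕ} {p : ℤ[X]}

lemma companion_pow_mulVec {i : ℕ} (hi : i < d) :
    ((companion d p) ^ i).mulVec (e₁ d) = Pi.single (⟨i, hi⟩ : Fin d) 1 := by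
  induction i with
  | zero =>
    rw [pow_zero, Matrix.one_mulVec]
    ext j
    simp [e₁, Pi.single_apply, Fin.ext_iff]
  | succ i ih =>
    rw [pow_succ', ← Matrix.mulVec_mulVec, ih (by omega), Matrix.mulVec_single_one]
    ext j
    simp only [companion, Matrix.col_apply, Matrix.of_apply, Pi.single_apply, Fin.ext_iff]
    rw [if_neg (by omega)]

lemma companion_pow_natDegree_mulVec (hd : 0 < d) :
    ((companion d p) ^ d).mulVec (e₁ d) = fun i : Fin d => -p.coeff i := by
  obtain ⟨n, rfl⟩ : ∃ n, d = n + 1 := ⟨d - 1, by omega⟩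
  rw [pow_succ', ← Matrix.mulVec_mulVec, companion_pow_mulVec (Nat.lt_succ_self n),
    Matrix.mulVec_single_one]
  ext j
  simp [companion]

lemma aeval_companion_mulVec {f : ℤ[X]} (hf : f.natDegree < d) :
    (aeval (companion d p) f).mulVec (e₁ d) = fun i : Fin d => f.coeff i := by
  rw [aeval_eq_sum_range' hf, Matrix.sum_mulVec, Finset.sum_range]
  ext j
  rw [Finset.sum_apply]
  simp only [Matrix.smul_mulVec, companion_pow_mulVec (Fin.is_lt _), Fin.eta]
  simp [Pi.single_apply]

/-- `e₁` is a cyclic vector over `ℤ`, so vectors can be handled as polynomials. -/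
lemma exists_aeval_companion_mulVec (k : Fin d → ℤ) :
    ∃ f : ℤ[X], (aeval (companion d p) f).mulVec (e₁ d) = k := by
  rcases Nat.eq_zero_or_pos d with rfl | hd
  · exact ⟨0, Subsingleton.elim _ _⟩
  refine ⟨∑ i : Fin d, monomial (i : ℕ) (k i), ?_⟩
  rw [aeval_companion_mulVec]
  · ext j
    rw [finsetSum_coeff, Finset.sum_eq_single j]
    · simp
    · intro b _ hb
      rw [coeff_monomial, if_neg (by rwa [← Fin.ext_iff])]
    · simp
  · refine lt_of_le_of_lt (natDegree_sum_le_of_forall_le (n := d - 1) _ _ fun i _ => ?_) (by omega)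
    exact (natDegree_monomial_le _).trans (by omega)

/-- `p(M)` kills `e₁` by the choice of the last column. It commutes with every `f(M)`, hence kills
every `f(M) e₁`, that is, everything. -/
lemma aeval_companion (hp : p.Monic) (hpd : p.natDegree = d) (hd : 0 < d) :
    aeval (companion d p) p = 0 := by
  have h1 : (aeval (companion d p) p).mulVec (e₁ d) = 0 := by
    rw [aeval_eq_sum_range, Finset.sum_range_succ, Matrix.add_mulVec, Matrix.sum_mulVec, hpd,
      Finset.sum_range]
    simp only [Matrix.smul_mulVec, companion_pow_mulVec (Fin.is_lt _), Fin.eta,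
      companion_pow_natDegree_mulVec hd]
    ext j
    have hlead : p.coeff d = 1 := by rw [← hpd, hp.coeff_natDegree]
    rw [hlead]
    simp [Finset.sum_apply, Pi.single_apply]
  refine Matrix.ext_of_mulVec_single fun i => ?_
  obtain ⟨f, hf⟩ := exists_aeval_companion_mulVec (p := p) (Pi.single i (1 : ℤ))
  rw [← hf, Matrix.mulVec_mulVec, ← map_mul, mul_comm, map_mul, ← Matrix.mulVec_mulVec, h1]
  simp

/-- The difference of the two monic polynomials has degree below `d` and annihilates `M`, yet its
coefficients are the entries of its value at `M` applied to `e₁`. -/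
lemma charpoly_companion (hp : p.Monic) (hpd : p.natDegree = d) (hd : 0 < d) :
    (companion d p).charpoly = p := by
  by_contra hne
  have hq : ((companion d p).charpoly - p).natDegree < d := by
    rw [natDegree_lt_iff_degree_lt (sub_ne_zero.2 hne)]
    have h := degree_sub_lt_left (p := (companion d p).charpoly) (q := p) ?_
      (Matrix.charpoly_monic _).ne_zero
      ((Matrix.charpoly_monic _).leadingCoeff.trans hp.leadingCoeff.symm)
    · rwa [Matrix.charpoly_degree_eq_dim, Fintype.card_fin] at h
    · rw [Matrix.charpoly_degree_eq_dim, Fintype.card_fin, degree_eq_natDegree hp.ne_zero, hpd]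
  have h := aeval_companion_mulVec (p := p) hq
  rw [map_sub, Matrix.aeval_self_charpoly, aeval_companion hp hpd hd, sub_zero,
    Matrix.zero_mulVec] at h
  refine sub_ne_zero.2 hne (Polynomial.ext fun i => ?_)
  by_cases hi : i < d
  · exact (congrFun h ⟨i, hi⟩).symm
  · rw [coeff_zero, coeff_eq_zero_of_natDegree_lt (by omega)]

lemma det_natAbs_eq_charpoly_coeff_zero (N : Matrix (Fin d) (Fin d) ℤ) :
    N.det.natAbs = (N.charpoly.coeff 0).natAbs := by
  rw [Matrix.det_eq_sign_charpoly_coeff, Int.natAbs_mul, Int.natAbs_pow]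
  simp

lemma mem_spectrum_iff_aeval_charpoly (N : Matrix (Fin d) (Fin d) ℤ) (z : ℂ) :
    z ∈ spectrum ℂ (N.map ((↑) : ℤ → ℂ)) ↔ aeval z N.charpoly = 0 := by
  have : N.map ((↑) : ℤ → ℂ) = N.map (algebraMap ℤ ℂ) := rfl
  rw [Matrix.mem_spectrum_iff_isRoot_charpoly, this, Matrix.charpoly_map, IsRoot.def,
    eval_map_algebraMap]

lemma expandingMatrix_iff (N : Matrix (Fin d) (Fin d) ℤ) :
    ExpandingMatrix N ↔ ExpandingPoly N.charpoly :=
  forall_congr' fun z => by rw [mem_spectrum_iff_aeval_charpoly]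

/-- Horner's scheme: a ternary polynomial is built from `0` by the moves `g ↦ X g + ε`. -/
lemma mulVec_induction_of_coeff {M : Matrix (Fin d) (Fin d) ℤ} {e : Fin d → ℤ}
    {S : Set (Fin d → ℤ)} (h0 : 0 ∈ S)
    (hS : ∀ k ∈ S, M.mulVec k ∈ S ∧ M.mulVec k + e ∈ S ∧ M.mulVec k - e ∈ S) :
    ∀ (n : ℕ) (g : ℤ[X]), g.natDegree < n →
      (∀ i, g.coeff i = -1 ∨ g.coeff i = 0 ∨ g.coeff i = 1) → (aeval M g).mulVec e ∈ S := by
  intro n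
  induction n with
  | zero => intro g hg; omega
  | succ n ih =>
    intro g hg hc
    have key : (aeval M g).mulVec e
        = M.mulVec ((aeval M g.divX).mulVec e) + g.coeff 0 • e := by
      conv_lhs => rw [← X_mul_divX_add g]
      rw [map_add, map_mul, aeval_X, aeval_C, Matrix.add_mulVec, Matrix.mulVec_mulVec,
        Algebra.algebraMap_eq_smul_one, Matrix.smul_mulVec, Matrix.one_mulVec]
    have hmem : (aeval M g.divX).mulVec e ∈ S := by
      rcases Nat.eq_zero_or_pos g.natDegree with hz | hpos
      · rw [divX_eq_zero_iff.2 (eq_C_of_natDegree_eq_zero hz)]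
        simpa using h0
      · refine ih _ (by rw [natDegree_divX_eq_natDegree_tsub_one]; omega) fun i => ?_
        rw [coeff_divX]; exact hc _
    obtain ⟨h1, h2, h3⟩ := hS _ hmem
    rw [key]
    rcases hc 0 with h | h | h <;> rw [h]
    · simpa [sub_eq_add_neg] using h3
    · simpa using h1
    · simpa using h2

lemma isTernaryDigit_companion (hp : p.Monic) (hpd : p.natDegree = d) (he : ExpandingPoly p)
    (h0 : p.coeff 0 = 2 ∨ p.coeff 0 = -2) (hiso : IsotropicPoly p) :
    IsTernaryDigit (companion d p) (e₁ d) := by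
  have hd : 0 < d := hpd ▸ natDegree_pos_of_coeff_zero hp h0
  have hcp := charpoly_companion hp hpd hd
  have hann := aeval_companion hp hpd hd
  have hsplit : ∀ f : ℤ[X], (aeval (companion d p) f).mulVec (e₁ d)
      = (companion d p).mulVec ((aeval (companion d p) f.divX).mulVec (e₁ d))
        + f.coeff 0 • e₁ d := fun f => by
    conv_lhs => rw [← X_mul_divX_add f]
    rw [map_add, map_mul, aeval_X, aeval_C, Matrix.add_mulVec, Matrix.mulVec_mulVec,
      Algebra.algebraMap_eq_smul_one, Matrix.smul_mulVec, Matrix.one_mulVec]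
  refine ⟨?_, ?_, ?_, ?_, ?_⟩
  · rw [expandingMatrix_iff, hcp]; exact he
  · rw [det_natAbs_eq_charpoly_coeff_zero, hcp]
    rcases h0 with h | h <;> rw [h] <;> rfl
  · intro t ht
    have h1 := congrFun ht ⟨0, hd⟩
    -- The first row of the companion matrix is zero except for its last entry `-p(0) = ∓2`.
    have h2 : (2 : ℤ) ∣ (companion d p).mulVec t ⟨0, hd⟩ := by
      rw [Matrix.mulVec, dotProduct]
      refine Finset.dvd_sum fun j _ => dvd_mul_of_dvd_left ?_ _
      simp only [companion, Matrix.of_apply]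
      split_ifs with ha hb
      · rcases h0 with h | h <;> rw [h] <;> norm_num
      · simp at hb
      · exact dvd_zero _
    rw [← h1] at h2
    norm_num [e₁] at h2
  · intro k
    obtain ⟨f, rfl⟩ := exists_aeval_companion_mulVec (p := p) k
    -- `p(M) e₁ = 0` expresses `p(0) e₁` as an element of `M ℤ^d`, so only the parity of `f(0)`
    -- matters for the residue.
    have h2 : ∃ s, (2 : ℤ) • e₁ d = (companion d p).mulVec s := by
      have h3 := hsplit p
      rw [hann, Matrix.zero_mulVec] at h3
      rcases h0 with h | h <;> rw [h] at h3
      · refine ⟨-((aeval (companion d p) p.divX).mulVec (e₁ d)), ?_⟩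
        rw [Matrix.mulVec_neg, ← add_eq_zero_iff_eq_neg, add_comm]; exact h3.symm
      · refine ⟨(aeval (companion d p) p.divX).mulVec (e₁ d), ?_⟩
        rw [neg_smul, ← sub_eq_add_neg] at h3
        exact (sub_eq_zero.1 h3.symm).symm
    obtain ⟨s, hs⟩ := h2
    refine ⟨(aeval (companion d p) f.divX).mulVec (e₁ d) + (f.coeff 0 / 2) • s, ?_⟩
    rw [hsplit f, Matrix.mulVec_add, Matrix.mulVec_smul, ← hs, smul_smul, add_assoc]
    rcases Int.emod_two_eq_zero_or_one (f.coeff 0) with h | h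
    · left; congr 2; omega
    · right; congr 1
      nth_rewrite 3 [← one_smul ℤ (e₁ d)]
      rw [← add_smul]; congr 1; omega
  · intro S hS0 hS k
    obtain ⟨f, rfl⟩ := exists_aeval_companion_mulVec (p := p) k
    obtain ⟨g, hg, q, hq⟩ := ternaryMod_of_isotropic hp he h0 hiso f
    have : aeval (companion d p) f = aeval (companion d p) g := by
      rw [← sub_eq_zero, ← map_sub, hq, map_mul, hann, zero_mul]
    rw [this]
    exact mulVec_induction_of_coeff hS0 hS _ g (Nat.lt_succ_self _) hg

end Companion

/-! ### Summability of the powers of `M⁻¹` -/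

section Contraction

attribute [local instance] Matrix.linftyOpNormedRing Matrix.linftyOpNormedAlgebra

variable {d : ℕ} {M : Matrix (Fin d) (Fin d) ℤ}

lemma toReal_eq_map (M : Matrix (Fin d) (Fin d) ℤ) : toReal M = (Int.castRingHom ℝ).mapMatrix M :=
  rfl

lemma det_toReal (M : Matrix (Fin d) (Fin d) ℤ) : (toReal M).det = (M.det : ℝ) := by
  rw [toReal_eq_map, ← RingHom.map_det]; rfl

lemma isUnit_det_toReal (h : M.det ≠ 0) : IsUnit (toReal M).det := by
  rw [det_toReal, isUnit_iff_ne_zero]; exact_mod_cast h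

lemma toReal_mulVec (M : Matrix (Fin d) (Fin d) ℤ) (k : Fin d → ℤ) :
    (toReal M).mulVec (vecReal k) = vecReal (M.mulVec k) := by
  ext i; simp [toReal, vecReal, Matrix.mulVec, dotProduct]

lemma vecReal_add (k l : Fin d → ℤ) : vecReal (k + l) = vecReal k + vecReal l := by
  ext i; simp [vecReal]

lemma vecReal_sub (k l : Fin d → ℤ) : vecReal (k - l) = vecReal k - vecReal l := by
  ext i; simp [vecReal]

lemma vecReal_neg (k : Fin d → ℤ) : vecReal (-k) = -vecReal k := by
  ext i; simp [vecReal]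

lemma vecReal_zero : vecReal (0 : Fin d → ℤ) = 0 := by
  ext i; simp [vecReal]

lemma norm_map_ofReal (A : Matrix (Fin d) (Fin d) ℝ) :
    ‖Complex.ofRealHom.mapMatrix A‖ = ‖A‖ := by
  simp [Matrix.linfty_opNorm_def]

/-- A complex matrix with spectral radius less than one has absolutely summable powers. -/
lemma summable_norm_pow_of_spectrum (hd : 0 < d) {B : Matrix (Fin d) (Fin d) ℂ}
    (hB : ∀ z ∈ spectrum ℂ B, ‖z‖ < 1) : Summable fun n : ℕ => ‖B ^ n‖ := by
  have : Nonempty (Fin d) := ⟨⟨0, hd⟩⟩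
  have h1 : spectralRadius ℂ B < (1 : NNReal) :=
    spectrum.spectralRadius_lt_of_forall_lt_of_nonempty (spectrum.nonempty B) hB
  -- With `c` between the spectral radius and `1`, Gelfand's formula gives `‖B^n‖ ≤ c^n` for large
  -- `n`.
  obtain ⟨c, hc1, hc2⟩ := ENNReal.lt_iff_exists_nnreal_btwn.1 h1
  have h2 := (spectrum.pow_nnnorm_pow_one_div_tendsto_nhds_spectralRadius B).eventually_lt_const hc1
  have hc : (c : ℝ) < 1 := by exact_mod_cast hc2
  refine Summable.of_norm_bounded_eventually_nat
    (summable_geometric_of_lt_one c.coe_nonneg hc) ?_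
  filter_upwards [h2, Filter.eventually_gt_atTop 0] with n hn hn0
  have h3 : (‖B ^ n‖₊ : ENNReal) ≤ (c : ENNReal) ^ n := by
    have h4 := ENNReal.rpow_le_rpow hn.le (Nat.cast_nonneg (α := ℝ) n)
    rw [← ENNReal.rpow_mul, one_div, inv_mul_cancel₀ (by positivity), ENNReal.rpow_one,
      ENNReal.rpow_natCast] at h4
    exact h4
  rw [norm_norm]
  exact_mod_cast h3

lemma ExpandingMatrix.summable_norm_inv_pow (hd : 0 < d) (hM : ExpandingMatrix M)
    (hdet : M.det ≠ 0) : Summable fun n : ℕ => ‖(toReal M)⁻¹ ^ n‖ := by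
  have hu := isUnit_det_toReal hdet
  have h1 : Complex.ofRealHom.mapMatrix (toReal M) = M.map ((↑) : ℤ → ℂ) := by
    ext i j; simp [toReal]
  let u : (Matrix (Fin d) (Fin d) ℂ)ˣ :=
    ⟨M.map ((↑) : ℤ → ℂ), Complex.ofRealHom.mapMatrix (toReal M)⁻¹,
      by rw [← h1, ← map_mul, Matrix.mul_nonsing_inv _ hu, map_one],
      by rw [← h1, ← map_mul, Matrix.nonsing_inv_mul _ hu, map_one]⟩
  have h2 : ∀ z ∈ spectrum ℂ (Complex.ofRealHom.mapMatrix (toReal M)⁻¹), ‖z‖ < 1 := by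
    intro z hz
    have hz' : z ∈ spectrum ℂ (↑u⁻¹ : Matrix (Fin d) (Fin d) ℂ) := hz
    have hz0 : z ≠ 0 := spectrum.ne_zero_of_mem_of_unit hz'
    have h3 := hM (z⁻¹)
      ((spectrum.inv_mem_iff (r := (Units.mk0 z hz0)⁻¹) (a := u)).2 (by simpa using hz'))
    rw [norm_inv, one_lt_inv₀ (norm_pos_iff.2 hz0)] at h3
    exact h3
  refine (summable_norm_pow_of_spectrum hd h2).congr fun n => ?_
  rw [← map_pow, norm_map_ofReal]

lemma exists_bound_inv_pow_mulVec (hd : 0 < d) (hM : ExpandingMatrix M) (hdet : M.det ≠ 0) :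
    ∃ c : ℕ → ℝ, Summable c ∧ ∀ n v, ‖((toReal M)⁻¹ ^ n).mulVec v‖ ≤ c n * ‖v‖ :=
  ⟨_, hM.summable_norm_inv_pow hd hdet, fun _ _ => Matrix.linfty_opNorm_mulVec _ _⟩

end Contraction

/-! ### Compactness and self-similarity of the attractor -/

section Attractor

variable {d : ℕ} {M : Matrix (Fin d) (Fin d) ℤ} {D : Finset (Fin d → ℤ)}

lemma continuous_mulVec (A : Matrix (Fin d) (Fin d) ℝ) : Continuous fun x => A.mulVec x :=
  A.mulVecLin.continuous_of_finiteDimensional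

lemma summable_attractor_bound (hd : 0 < d) (hM : ExpandingMatrix M) (hdet : M.det ≠ 0)
    (D : Finset (Fin d → ℤ)) :
    ∃ b : ℕ → ℝ, Summable b ∧ ∀ a ∈ D, ∀ n,
      ‖((toReal M)⁻¹ ^ (n + 1)).mulVec (vecReal a)‖ ≤ b n := by
  obtain ⟨c, hc, hcb⟩ := exists_bound_inv_pow_mulVec hd hM hdet
  refine ⟨fun n => |c (n + 1)| * ∑ a ∈ D, ‖vecReal a‖,
    (((summable_nat_add_iff 1).2 hc).abs).mul_right _, fun a ha n => ?_⟩
  refine (hcb _ _).trans (mul_le_mul (le_abs_self _) ?_ (norm_nonneg _) (abs_nonneg _))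
  exact Finset.single_le_sum (f := fun a => ‖vecReal a‖) (fun _ _ => norm_nonneg _) ha

lemma summable_attractor (hd : 0 < d) (hM : ExpandingMatrix M) (hdet : M.det ≠ 0)
    {a : ℕ → Fin d → ℤ} (ha : ∀ k, a k ∈ D) :
    Summable fun k : ℕ => ((toReal M)⁻¹ ^ (k + 1)).mulVec (vecReal (a k)) := by
  obtain ⟨b, hb, hbb⟩ := summable_attractor_bound hd hM hdet D
  exact Summable.of_norm_bounded hb fun n => hbb _ (ha n) n

/-- The attractor is the image of the compact space of digit sequences under a uniformly convergent
series of continuous maps. -/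
lemma isCompact_attractor (hd : 0 < d) (hM : ExpandingMatrix M) (hdet : M.det ≠ 0) :
    IsCompact (attractor M D) := by
  obtain ⟨b, hb, hbb⟩ := summable_attractor_bound hd hM hdet D
  let S : (ℕ → D) → Fin d → ℝ := fun a =>
    ∑' k : ℕ, ((toReal M)⁻¹ ^ (k + 1)).mulVec (vecReal (a k : Fin d → ℤ))
  have hS : Continuous S := by
    refine continuous_tsum (fun k => ?_) hb fun k a => hbb _ (a k).2 k
    have : Continuous fun x : D => ((toReal M)⁻¹ ^ (k + 1)).mulVec (vecReal (x : Fin d → ℤ)) :=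
      continuous_of_discreteTopology
    exact this.comp (continuous_apply k)
  have : attractor M D = Set.range S := by
    ext x
    constructor
    · rintro ⟨a, ha, hx⟩
      exact ⟨fun k => ⟨a k, ha k⟩, hx.tsum_eq⟩
    · rintro ⟨a, rfl⟩
      exact ⟨fun k => a k, fun k => (a k).2, (summable_attractor hd hM hdet fun k => (a k).2).hasSum⟩
  rw [this]
  exact isCompact_range hS

lemma nonempty_attractor (hd : 0 < d) (hM : ExpandingMatrix M) (hdet : M.det ≠ 0)
    (hD : D.Nonempty) : (attractor M D).Nonempty := by
  obtain ⟨a, ha⟩ := hD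
  exact ⟨_, fun _ => a, fun _ => ha, (summable_attractor hd hM hdet fun _ => ha).hasSum⟩

/-- The self-similarity of the attractor: `M G = ⋃ a ∈ D, G + a`. -/
lemma mem_attractor_iff (hdet : M.det ≠ 0) (x : Fin d → ℝ) :
    x ∈ attractor M D ↔ ∃ a ∈ D, (toReal M).mulVec x - vecReal a ∈ attractor M D := by
  have hu := isUnit_det_toReal hdet
  constructor
  · rintro ⟨a, ha, hx⟩
    refine ⟨a 0, ha 0, fun k => a (k + 1), fun k => ha _, ?_⟩
    have h1 := ((hasSum_nat_add_iff' 1).2 hx).map (toReal M).mulVecLin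
      (continuous_mulVec (toReal M))
    simp only [Finset.range_one, Finset.sum_singleton, zero_add, pow_one, map_sub,
      Matrix.mulVecLin_apply, Matrix.mulVec_mulVec, Matrix.mul_nonsing_inv _ hu,
      Matrix.one_mulVec] at h1
    refine h1.congr_fun fun k => ?_
    simp only [Function.comp, Matrix.mulVecLin_apply, Matrix.mulVec_mulVec]
    rw [pow_succ' _ (k + 1), ← mul_assoc, Matrix.mul_nonsing_inv _ hu, one_mul]
  · rintro ⟨a, ha, b, hb, hx⟩
    refine ⟨fun k => Nat.casesOn k a b, fun k => ?_, ?_⟩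
    · cases k with
      | zero => exact ha
      | succ k => exact hb k
    · rw [← hasSum_nat_add_iff' 1]
      have h1 := hx.map (toReal M)⁻¹.mulVecLin (continuous_mulVec (toReal M)⁻¹)
      simp only [map_sub, Matrix.mulVecLin_apply, Matrix.mulVec_mulVec,
        Matrix.nonsing_inv_mul _ hu, Matrix.one_mulVec] at h1
      simp only [Finset.range_one, Finset.sum_singleton, zero_add, pow_one]
      refine h1.congr_fun fun k => ?_
      simp only [Function.comp, Matrix.mulVecLin_apply, Matrix.mulVec_mulVec]
      rw [← pow_succ']

end Attractor

/-! ### The attractor of a ternary digit is a tile -/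

section Tile

open scoped Pointwise

variable {d : ℕ} {M : Matrix (Fin d) (Fin d) ℤ} {e : Fin d → ℤ}

lemma isClosed_range_vecReal : IsClosed (Set.range (vecReal : (Fin d → ℤ) → Fin d → ℝ)) := by
  have : Set.range (vecReal : (Fin d → ℤ) → Fin d → ℝ)
      = Set.univ.pi fun _ => Set.range ((↑) : ℤ → ℝ) := by
    ext x
    simp only [Set.mem_range, Set.mem_univ_pi]
    constructor
    · rintro ⟨k, rfl⟩ i; exact ⟨k i, rfl⟩
    · intro h
      choose k hk using h
      exact ⟨k, funext hk⟩
  rw [this]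
  exact isClosed_set_pi fun _ _ => Int.isClosedEmbedding_coe_real.isClosed_range

namespace IsTernaryDigit

lemma det_ne_zero (h : IsTernaryDigit M e) : M.det ≠ 0 := by
  intro h0; have := h.det_natAbs; rw [h0] at this; simp at this

lemma dim_pos (h : IsTernaryDigit M e) : 0 < d := by
  rcases Nat.eq_zero_or_pos d with rfl | hd
  · have := h.det_natAbs; simp at this
  · exact hd

lemma ne_zero (h : IsTernaryDigit M e) : e ≠ 0 := by
  have := h.not_mem 0
  rwa [Matrix.mulVec_zero] at this

lemma isDigitSystem (h : IsTernaryDigit M e) : IsDigitSystem M {0, e} := by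
  refine ⟨h.expanding, ?_, ?_⟩
  · rw [Finset.card_pair h.ne_zero.symm, h.det_natAbs]
  · intro a ha b hb hab
    simp only [Finset.mem_insert, Finset.mem_singleton] at ha hb
    rintro ⟨k, hk⟩
    rcases ha with rfl | rfl <;> rcases hb with rfl | rfl
    · exact hab rfl
    · exact h.not_mem (-k) (by rw [Matrix.mulVec_neg, ← hk]; simp)
    · exact h.not_mem k (by rw [← hk]; simp)
    · exact hab rfl

lemma mem_iff (h : IsTernaryDigit M e) (x : Fin d → ℝ) :
    x ∈ attractor M {0, e} ↔ (toReal M).mulVec x ∈ attractor M {0, e} ∨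
      (toReal M).mulVec x - vecReal e ∈ attractor M {0, e} := by
  rw [mem_attractor_iff h.det_ne_zero]
  simp [vecReal_zero]

lemma isCompact (h : IsTernaryDigit M e) : IsCompact (attractor M {0, e}) :=
  isCompact_attractor h.dim_pos h.expanding h.det_ne_zero

/-- The integer translates of the attractor cover the space. -/
lemma exists_sub_mem (h : IsTernaryDigit M e) (x : Fin d → ℝ) :
    ∃ k, x - vecReal k ∈ attractor M {0, e} := by
  set F : Set (Fin d → ℝ) := {x | ∃ k, x - vecReal k ∈ attractor M {0, e}} with hF
  have hFclosed : IsClosed F := by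
    have : F = Set.range (vecReal (d := d)) + attractor M {0, e} := by
      ext y
      constructor
      · rintro ⟨k, hk⟩
        exact ⟨_, ⟨k, rfl⟩, _, hk, by simp⟩
      · rintro ⟨_, ⟨k, rfl⟩, g, hg, rfl⟩
        exact ⟨k, by simpa using hg⟩
    rw [this]
    exact isClosed_range_vecReal.add_right_of_isCompact h.isCompact
  -- The union `F` of the translates is stable under `M⁻¹`: write the translation vector as `M t` or
  -- `M t + e` and absorb the digit into `G`.
  have hinv : ∀ y, (toReal M).mulVec y ∈ F → y ∈ F := by
    rintro y ⟨l, hl⟩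
    obtain ⟨t, rfl | rfl⟩ := h.exists_residue l
    · exact ⟨t, (h.mem_iff _).2 (Or.inl (by rwa [Matrix.mulVec_sub, toReal_mulVec]))⟩
    · refine ⟨t, (h.mem_iff _).2 (Or.inr ?_)⟩
      rwa [Matrix.mulVec_sub, toReal_mulVec, sub_sub, ← vecReal_add]
  have hinvn : ∀ (n : ℕ) y, ((toReal M) ^ n).mulVec y ∈ F → y ∈ F := by
    intro n
    induction n with
    | zero => intro y hy; simpa using hy
    | succ n ih =>
      intro y hy
      refine hinv y (ih _ ?_)
      rwa [Matrix.mulVec_mulVec, ← pow_succ]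
  obtain ⟨g, hg⟩ := nonempty_attractor (D := {0, e}) h.dim_pos h.expanding h.det_ne_zero (by simp)
  obtain ⟨c, hc, hcb⟩ := exists_bound_inv_pow_mulVec h.dim_pos h.expanding h.det_ne_zero
  have hu := isUnit_det_toReal h.det_ne_zero
  have hinvpow : ∀ n : ℕ, (toReal M) ^ n * (toReal M)⁻¹ ^ n = 1 := fun n => by
    rw [← (Commute.mul_pow ?_ n), Matrix.mul_nonsing_inv _ hu, one_pow]
    rw [commute_iff_eq, Matrix.mul_nonsing_inv _ hu, Matrix.nonsing_inv_mul _ hu]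
  have hinvpow' : ∀ n : ℕ, (toReal M)⁻¹ ^ n * (toReal M) ^ n = 1 := fun n =>
    mul_eq_one_comm.1 (hinvpow n)
  -- Rounding `M^n x` to a lattice point `m` and pulling `m + g ∈ F` back by `M^{-n}` yields points
  -- of `F` tending to `x`; `F` is closed.
  let z : ℕ → Fin d → ℝ := fun n => ((toReal M) ^ n).mulVec x
  let r : ℕ → Fin d → ℝ := fun n => z n - vecReal (fun i => ⌊z n i⌋)
  have hr : ∀ n, ‖r n‖ ≤ 1 := fun n => by
    rw [pi_norm_le_iff_of_nonneg zero_le_one]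
    intro i
    change ‖z n i - (⌊z n i⌋ : ℝ)‖ ≤ 1
    rw [Int.self_sub_floor, Real.norm_of_nonneg (Int.fract_nonneg _)]
    exact (Int.fract_lt_one _).le
  have hmem : ∀ n, x - ((toReal M)⁻¹ ^ n).mulVec (r n - g) ∈ F := fun n => by
    refine hinvn n _ ⟨fun i => ⌊z n i⌋, ?_⟩
    rw [Matrix.mulVec_sub, Matrix.mulVec_mulVec, hinvpow, Matrix.one_mulVec]
    change z n - (z n - _ - g) - _ ∈ _
    convert hg using 1
    abel
  change x ∈ F
  refine hFclosed.mem_of_tendsto (b := Filter.atTop) (f := fun n : ℕ =>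
    x - ((toReal M)⁻¹ ^ n).mulVec (r n - g)) ?_ (Filter.Eventually.of_forall hmem)
  have hlim : Filter.Tendsto (fun n : ℕ => ((toReal M)⁻¹ ^ n).mulVec (r n - g)) Filter.atTop
      (nhds 0) := by
    have hc0 := hc.abs.tendsto_atTop_zero.mul_const (1 + ‖g‖)
    rw [zero_mul] at hc0
    refine squeeze_zero_norm (fun n => (hcb n _).trans ?_) hc0
    refine mul_le_mul (le_abs_self _) ?_ (norm_nonneg _) (abs_nonneg _)
    exact (norm_sub_le _ _).trans (by linarith [hr n])
  simpa using hlim.const_sub x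

lemma volume_preimage (h : IsTernaryDigit M e) (s : Set (Fin d → ℝ)) :
    2 * volume ((fun x => (toReal M).mulVec x) ⁻¹' s) = volume s := by
  have hdet : LinearMap.det (Matrix.toLin' (toReal M)) ≠ 0 := by
    rw [LinearMap.det_toLin']; exact (isUnit_det_toReal h.det_ne_zero).ne_zero
  have h1 := Measure.addHaar_preimage_linearMap volume hdet s
  have h2 : |((toReal M).det)⁻¹| = (2 : ℝ)⁻¹ := by
    rw [abs_inv, det_toReal, ← Int.cast_abs, Int.abs_eq_natAbs, h.det_natAbs]; norm_num
  rw [LinearMap.det_toLin', h2, ENNReal.ofReal_inv_of_pos two_pos, ENNReal.ofReal_ofNat] at h1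
  have h3 : (fun x => (toReal M).mulVec x) ⁻¹' s = (Matrix.toLin' (toReal M)) ⁻¹' s := by
    ext x; simp
  rw [h3, h1, ← mul_assoc, ENNReal.mul_inv_cancel two_ne_zero ENNReal.ofNat_ne_top, one_mul]

lemma volume_translate (s : Set (Fin d → ℝ)) (v : Fin d → ℝ) :
    volume ((fun x => x - v) ⁻¹' s) = volume s := by
  simp only [sub_eq_add_neg]
  exact measure_preimage_add_right volume (-v) s

/-- The intersection of two translates of the attractor depends only on the difference. -/
lemma volume_inter_translate (G : Set (Fin d → ℝ)) (k l m : Fin d → ℤ) :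
    volume ({x | x - vecReal (k + m) ∈ G} ∩ {x | x - vecReal (l + m) ∈ G})
      = volume ({x | x - vecReal k ∈ G} ∩ {x | x - vecReal l ∈ G}) := by
  rw [← volume_translate ({x | x - vecReal k ∈ G} ∩ {x | x - vecReal l ∈ G}) (vecReal m)]
  congr 1
  ext x
  simp [vecReal_add, sub_sub, add_comm]

/-- Distinct integer translates of the attractor overlap in a null set. -/
lemma volume_inter_eq_zero (h : IsTernaryDigit M e) {k l : Fin d → ℤ} (hkl : k ≠ l) :
    volume ({x | x - vecReal k ∈ attractor M {0, e}} ∩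
      {x | x - vecReal l ∈ attractor M {0, e}}) = 0 := by
  set G := attractor M {0, e} with hG
  have hGfin : volume G ≠ ⊤ := h.isCompact.measure_lt_top.ne
  -- `G ∪ (G + e) = M G` has volume `2 vol G`, the sum of the volumes of its two parts, and this is
  -- finite.
  have he0 : volume ({x | x - vecReal 0 ∈ G} ∩ {x | x - vecReal e ∈ G}) = 0 := by
    have h0 : {x : Fin d → ℝ | x - vecReal 0 ∈ G} = G := by simp [vecReal_zero]
    have h1 : (fun x => (toReal M).mulVec x) ⁻¹' (G ∪ {x | x - vecReal e ∈ G}) = G := by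
      ext x; exact (h.mem_iff x).symm
    have h2 := h.volume_preimage (G ∪ {x | x - vecReal e ∈ G})
    rw [h1] at h2
    have hm : MeasurableSet {x : Fin d → ℝ | x - vecReal e ∈ G} :=
      h.isCompact.measurableSet.preimage (measurable_id.sub_const _)
    have h3 := measure_union_add_inter (μ := volume) G hm
    have h4 : volume {x : Fin d → ℝ | x - vecReal e ∈ G} = volume G := volume_translate G _
    rw [← h2, h4, two_mul] at h3
    rw [h0]
    have hfin : volume G + volume G ≠ ⊤ := ENNReal.add_ne_top.2 ⟨hGfin, hGfin⟩
    exact (ENNReal.add_right_inj hfin).1 (by rw [h3, add_zero])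
  have hnull : ∀ k : Fin d → ℤ, k = 0 ∨
      volume ({x | x - vecReal 0 ∈ G} ∩ {x | x - vecReal k ∈ G}) = 0 := by
    refine h.induction _ (Or.inl rfl) ?_
    rintro k (rfl | hk)
    · rw [Matrix.mulVec_zero, zero_add, zero_sub]
      refine ⟨Or.inl rfl, Or.inr he0, Or.inr ?_⟩
      rw [← volume_inter_translate G 0 (-e) e, zero_add, neg_add_cancel, Set.inter_comm]
      exact he0
    -- A set whose preimage under `M` lies in a null overlap is null; each of the three overlaps
    -- below is such a set.
    · have hpre : ∀ s : Set (Fin d → ℝ),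
          (fun x => (toReal M).mulVec x) ⁻¹' s ⊆
            {x | x - vecReal 0 ∈ G} ∩ {x | x - vecReal k ∈ G} → volume s = 0 := fun s hs => by
        rw [← h.volume_preimage s, measure_mono_null hs hk, mul_zero]
      have hM : ∀ x, (toReal M).mulVec x - vecReal (M.mulVec k)
          = (toReal M).mulVec (x - vecReal k) := fun x => by
        rw [Matrix.mulVec_sub, toReal_mulVec]
      refine ⟨Or.inr (hpre _ ?_), Or.inr (hpre _ ?_), Or.inr ?_⟩
      · rintro x ⟨h1, h2⟩
        simp only [vecReal_zero, sub_zero, Set.mem_ofPred_eq, Set.mem_inter_iff, hM] at h1 h2 ⊢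
        exact ⟨(h.mem_iff _).2 (Or.inl h1), (h.mem_iff _).2 (Or.inl h2)⟩
      · rintro x ⟨h1, h2⟩
        simp only [vecReal_zero, sub_zero, Set.mem_ofPred_eq, Set.mem_inter_iff, vecReal_add,
          ← sub_sub, hM] at h1 h2 ⊢
        exact ⟨(h.mem_iff _).2 (Or.inl h1), (h.mem_iff _).2 (Or.inr h2)⟩
      · rw [← volume_inter_translate G 0 _ e, zero_add, sub_add_cancel]
        refine hpre _ ?_
        rintro x ⟨h1, h2⟩
        simp only [vecReal_zero, sub_zero, Set.mem_ofPred_eq, Set.mem_inter_iff, hM] at h1 h2 ⊢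
        exact ⟨(h.mem_iff _).2 (Or.inr h1), (h.mem_iff _).2 (Or.inl h2)⟩
  have h1 := (hnull (l - k)).resolve_left (sub_ne_zero.2 hkl.symm)
  rwa [← volume_inter_translate G 0 _ k, zero_add, sub_add_cancel] at h1

/-- The attractor is a fundamental domain of the integer lattice, hence has measure one. -/
lemma volume_attractor (h : IsTernaryDigit M e) : volume (attractor M {0, e}) = 1 := by
  set b := Pi.basisFun ℝ (Fin d)
  have hmemspan : ∀ v : Fin d → ℝ, v ∈ (Submodule.span ℤ (Set.range b)).toAddSubgroup ↔ ∃ k, v = vecReal k := by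
    intro v
    rw [Submodule.mem_toAddSubgroup, Module.Basis.mem_span_iff_repr_mem]
    constructor
    · intro hv
      choose k hk using hv
      exact ⟨k, funext fun i => by simpa [b, vecReal] using (hk i).symm⟩
    · rintro ⟨k, rfl⟩ i
      exact ⟨k i, by simp [b, vecReal]⟩
  have hfd : IsAddFundamentalDomain ((Submodule.span ℤ (Set.range b)).toAddSubgroup) (attractor M {0, e})
      volume := by
    refine ⟨h.isCompact.measurableSet.nullMeasurableSet, Filter.Eventually.of_forall fun x => ?_,
      ?_⟩
    · obtain ⟨k, hk⟩ := h.exists_sub_mem x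
      refine ⟨⟨vecReal (-k), (hmemspan _).2 ⟨_, rfl⟩⟩, ?_⟩
      change vecReal (-k) + x ∈ _
      rwa [vecReal_neg, neg_add_eq_sub]
    · rintro ⟨v, hv⟩ ⟨w, hw⟩ hvw
      obtain ⟨k, rfl⟩ := (hmemspan v).1 hv
      obtain ⟨l, rfl⟩ := (hmemspan w).1 hw
      have hkl : k ≠ l := by rintro rfl; exact hvw rfl
      have hset : ∀ (k : Fin d → ℤ) (hk : vecReal k ∈ (Submodule.span ℤ (Set.range b)).toAddSubgroup),
          (⟨vecReal k, hk⟩ : (Submodule.span ℤ (Set.range b)).toAddSubgroup) +ᵥ attractor M {0, e}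
            = {x | x - vecReal k ∈ attractor M {0, e}} := by
        intro k hk
        ext x
        rw [Set.mem_vadd_set_iff_neg_vadd_mem]
        change -vecReal k + x ∈ _ ↔ _
        rw [neg_add_eq_sub]
        rfl
      change volume (_ ∩ _) = 0
      beta_reduce
      rw [hset, hset]
      exact h.volume_inter_eq_zero hkl
  have : Countable (Submodule.span ℤ (Set.range b)).toAddSubgroup :=
    inferInstanceAs (Countable (Submodule.span ℤ (Set.range b)))
  -- Two fundamental domains of one lattice have equal measure; the other one is the unit cube.
  rw [hfd.measure_eq (ZSpan.isAddFundamentalDomain' b volume), ZSpan.fundamentalDomain_pi_basisFun,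
    Real.volume_pi_Ico]
  simp

lemma generatesTwoTile (h : IsTernaryDigit M e) : GeneratesTwoTile M {0, e} :=
  ⟨⟨h.isDigitSystem, h.det_natAbs⟩, h.volume_attractor⟩

end IsTernaryDigit

end Tile

/-! ### Orthogonal refinable families in a Hilbert space -/

section Refinement

open scoped InnerProductSpace

variable {H Λ : Type*} [NormedAddCommGroup H] [InnerProductSpace ℂ H]

/-- A refinable family of orthogonal vectors: `w j k` plays the role of the characteristic
function of the `k`-th cell of level `j`, which splits into the cells `s₀ k` and `s₁ k` of
level `j + 1`. -/
structure IsRefinable (s₀ s₁ : Λ → Λ) (w : ℤ → Λ → H) : Prop where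
  inj₀ : Function.Injective s₀
  inj₁ : Function.Injective s₁
  ne : ∀ k l, s₀ k ≠ s₁ l
  surj : ∀ l, ∃ k, l = s₀ k ∨ l = s₁ k
  inner_ne : ∀ j k l, k ≠ l → ⟪w j k, w j l⟫_ℂ = 0
  inner_self : ∀ j k, ⟪w j k, w j k⟫_ℂ = (2 : ℂ) ^ (-j)
  split : ∀ j k, w j k = w (j + 1) (s₀ k) + w (j + 1) (s₁ k)
  total : ∀ f, (∀ j k, ⟪w j k, f⟫_ℂ = 0) → f = 0

/-- The differences of the two halves of a cell. -/
def refineDiff (s₀ s₁ : Λ → Λ) (w : ℤ → Λ → H) (j : ℤ) (k : Λ) : H :=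
  w (j + 1) (s₀ k) - w (j + 1) (s₁ k)

namespace IsRefinable

variable {s₀ s₁ : Λ → Λ} {w : ℤ → Λ → H}

/-- The two halves of a cell are orthogonal and of equal norm, so their sum is orthogonal to their
difference. -/
lemma inner_diff_same (h : IsRefinable s₀ s₁ w) (j : ℤ) (k l : Λ) :
    ⟪w j k, refineDiff s₀ s₁ w j l⟫_ℂ = 0 := by
  rw [h.split j k, refineDiff, inner_add_left, inner_sub_right, inner_sub_right,
    h.inner_ne _ _ _ (h.ne k l), h.inner_ne _ _ _ (h.ne l k).symm]
  by_cases hkl : k = l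
  · subst hkl; rw [h.inner_self, h.inner_self]; ring
  · rw [h.inner_ne _ _ _ (h.inj₀.ne hkl), h.inner_ne _ _ _ (h.inj₁.ne hkl)]; ring

/-- A coarser cell is a sum of cells of the next level, so the level descends one step at a time. -/
lemma inner_diff (h : IsRefinable s₀ s₁ w) {i j : ℤ} (hij : i ≤ j) (k l : Λ) :
    ⟪w i k, refineDiff s₀ s₁ w j l⟫_ℂ = 0 := by
  induction i, hij using Int.leInductionDown generalizing k with
  | base => exact h.inner_diff_same j k l
  | pred n _ ih =>
    rw [h.split (n - 1) k, sub_add_cancel, inner_add_left, ih, ih, add_zero]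

lemma inner_diff_diff_of_lt (h : IsRefinable s₀ s₁ w) {i j : ℤ} (hij : i < j) (k l : Λ) :
    ⟪refineDiff s₀ s₁ w i k, refineDiff s₀ s₁ w j l⟫_ℂ = 0 := by
  rw [refineDiff, inner_sub_left, h.inner_diff hij, h.inner_diff hij, sub_zero]

lemma inner_diff_diff_ne (h : IsRefinable s₀ s₁ w) {i j : ℤ} {k l : Λ} (hne : (i, k) ≠ (j, l)) :
    ⟪refineDiff s₀ s₁ w i k, refineDiff s₀ s₁ w j l⟫_ℂ = 0 := by
  rcases lt_trichotomy i j with hij | rfl | hij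
  · exact h.inner_diff_diff_of_lt hij k l
  · have hkl : k ≠ l := fun hkl => hne (by rw [hkl])
    simp only [refineDiff, inner_sub_left, inner_sub_right,
      h.inner_ne _ _ _ (h.ne k l), h.inner_ne _ _ _ (h.ne l k).symm,
      h.inner_ne _ _ _ (h.inj₀.ne hkl), h.inner_ne _ _ _ (h.inj₁.ne hkl), sub_zero]
  · rw [inner_eq_zero_symm]; exact h.inner_diff_diff_of_lt hij l k

lemma inner_diff_diff_self (h : IsRefinable s₀ s₁ w) (j : ℤ) (k : Λ) :
    ⟪refineDiff s₀ s₁ w j k, refineDiff s₀ s₁ w j k⟫_ℂ = (2 : ℂ) ^ (-j) := by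
  simp only [refineDiff, inner_sub_left, inner_sub_right, h.inner_self,
    h.inner_ne _ _ _ (h.ne k k), h.inner_ne _ _ _ (h.ne k k).symm, sub_zero, zero_sub,
    sub_neg_eq_add]
  rw [show -(j + 1) = -j - 1 by ring, zpow_sub_one₀ two_ne_zero]
  ring

lemma norm_sq (h : IsRefinable s₀ s₁ w) (j : ℤ) (k : Λ) : ‖w j k‖ ^ 2 = (2 : ℝ) ^ (-j) := by
  rw [norm_sq_eq_re_inner (𝕜 := ℂ), h.inner_self,
    show (2 : ℂ) ^ (-j) = (((2 : ℝ) ^ (-j) : ℝ) : ℂ) by push_cast; rfl]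
  exact Complex.ofReal_re _

/-- The differences of the halves of all cells are total. -/
lemma eq_zero_of_inner_diff (h : IsRefinable s₀ s₁ w) {f : H}
    (hf : ∀ j k, ⟪refineDiff s₀ s₁ w j k, f⟫_ℂ = 0) : f = 0 := by
  -- Orthogonality to the difference makes the products with both halves equal, so the parent's is
  -- twice either one.
  have hhalf : ∀ j l, ∃ k, ⟪w j k, f⟫_ℂ = 2 * ⟪w (j + 1) l, f⟫_ℂ := by
    intro j l
    obtain ⟨k, hk⟩ := h.surj l
    refine ⟨k, ?_⟩
    have h1 := hf j k
    rw [refineDiff, inner_sub_left, sub_eq_zero] at h1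
    rw [h.split j k, inner_add_left]
    rcases hk with rfl | rfl
    · rw [h1]; ring
    · rw [h1]; ring
  have hup : ∀ (n : ℕ) j l, ∃ k, ⟪w (j - n) k, f⟫_ℂ = 2 ^ n * ⟪w j l, f⟫_ℂ := by
    intro n
    induction n with
    | zero => intro j l; exact ⟨l, by simp⟩
    | succ n ih =>
      intro j l
      obtain ⟨k, hk⟩ := ih j l
      have hj : j - (n : ℤ) = (j - ((n + 1 : ℕ) : ℤ)) + 1 := by push_cast; ring
      rw [hj] at hk
      obtain ⟨k', hk'⟩ := hhalf (j - ((n + 1 : ℕ) : ℤ)) k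
      exact ⟨k', by rw [hk', hk, pow_succ]; ring⟩
  refine h.total f fun j l => ?_
  by_contra hne
  have hpos : 0 < ‖⟪w j l, f⟫_ℂ‖ ^ 2 := by have := norm_pos_iff.2 hne; positivity
  -- Going up `n` levels multiplies the squared product by `4^n` but the squared norm of the cell
  -- only by `2^n`.
  have hbound : ∀ n : ℕ, (2 : ℝ) ^ n * ‖⟪w j l, f⟫_ℂ‖ ^ 2 ≤ (2 : ℝ) ^ (-j) * ‖f‖ ^ 2 := by
    intro n
    obtain ⟨k, hk⟩ := hup n j l
    have h1 := norm_inner_le_norm (𝕜 := ℂ) (w (j - n) k) f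
    rw [hk, norm_mul, norm_pow, Complex.norm_ofNat] at h1
    have h2 := pow_le_pow_left₀ (by positivity) h1 2
    rw [mul_pow, mul_pow, h.norm_sq, show -(j - (n : ℤ)) = n + -j by ring,
      zpow_add₀ two_ne_zero, zpow_natCast] at h2
    have h3 : (0 : ℝ) < 2 ^ n := by positivity
    refine le_of_mul_le_mul_left ?_ h3
    calc (2 : ℝ) ^ n * (2 ^ n * ‖⟪w j l, f⟫_ℂ‖ ^ 2) = (2 ^ n) ^ 2 * ‖⟪w j l, f⟫_ℂ‖ ^ 2 := by ring
      _ ≤ _ := h2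
      _ = _ := by ring
  obtain ⟨n, hn⟩ := pow_unbounded_of_one_lt
    ((2 : ℝ) ^ (-j) * ‖f‖ ^ 2 / ‖⟪w j l, f⟫_ℂ‖ ^ 2) one_lt_two
  rw [div_lt_iff₀ hpos] at hn
  exact absurd (hbound n) (not_le.2 hn)

/-- The normalised differences of the halves of the cells are orthonormal. -/
lemma orthonormal_diff (h : IsRefinable s₀ s₁ w) :
    Orthonormal ℂ fun x : ℤ × Λ => (((Real.sqrt 2) ^ x.1 : ℝ) : ℂ) • refineDiff s₀ s₁ w x.1 x.2 := by
  classical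
  rw [orthonormal_iff_ite]
  rintro ⟨i, k⟩ ⟨j, l⟩
  rw [inner_smul_left, inner_smul_right]
  split_ifs with hij
  · obtain ⟨rfl, rfl⟩ := Prod.mk.inj hij
    rw [h.inner_diff_diff_self, Complex.conj_ofReal, ← mul_assoc, ← Complex.ofReal_mul,
      ← mul_zpow, Real.mul_self_sqrt zero_le_two]
    push_cast
    rw [zpow_neg, mul_inv_cancel₀ (zpow_ne_zero _ two_ne_zero)]
  · rw [h.inner_diff_diff_ne hij, mul_zero, mul_zero]

lemma exists_hilbertBasis [CompleteSpace H] (h : IsRefinable s₀ s₁ w) :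
    ∃ b : HilbertBasis (ℤ × Λ) ℂ H, ∀ j k,
      b (j, k) = (((Real.sqrt 2) ^ j : ℝ) : ℂ) • refineDiff s₀ s₁ w j k := by
  refine ⟨HilbertBasis.mkOfOrthogonalEqBot h.orthonormal_diff ?_, fun j k => by simp⟩
  rw [Submodule.eq_bot_iff]
  intro f hf
  refine h.eq_zero_of_inner_diff fun j k => ?_
  have h1 := (Submodule.mem_orthogonal _ f).1 hf _ (Submodule.subset_span ⟨(j, k), rfl⟩)
  rw [inner_smul_left, mul_eq_zero] at h1
  refine h1.resolve_left ?_
  rw [Complex.conj_ofReal, ← ne_eq, Complex.ofReal_ne_zero]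
  exact zpow_ne_zero _ (Real.sqrt_ne_zero'.2 two_pos)

/-- The closed span of the cells of level `j`. -/
def _root_.TwoAttractor.levelSpace (w : ℤ → Λ → H) (j : ℤ) : Submodule ℂ H :=
  (Submodule.span ℂ (Set.range (w j))).topologicalClosure

lemma mem_levelSpace (w : ℤ → Λ → H) (j : ℤ) (k : Λ) : w j k ∈ levelSpace w j :=
  Submodule.le_topologicalClosure _ (Submodule.subset_span ⟨k, rfl⟩)

lemma isClosed_levelSpace (w : ℤ → Λ → H) (j : ℤ) : IsClosed (levelSpace w j : Set H) :=
  Submodule.isClosed_topologicalClosure _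

lemma levelSpace_le (h : IsRefinable s₀ s₁ w) (j : ℤ) :
    levelSpace w j ≤ levelSpace w (j + 1) := by
  refine Submodule.topologicalClosure_minimal _ (Submodule.span_le.2 ?_) (isClosed_levelSpace w _)
  rintro _ ⟨k, rfl⟩
  rw [h.split]
  exact add_mem (mem_levelSpace w _ _) (mem_levelSpace w _ _)

lemma iSup_levelSpace [CompleteSpace H] (h : IsRefinable s₀ s₁ w) :
    (⨆ j, levelSpace w j).topologicalClosure = ⊤ := by
  rw [Submodule.topologicalClosure_eq_top_iff, Submodule.eq_bot_iff]
  intro f hf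
  exact h.total f fun j k => (Submodule.mem_orthogonal _ f).1 hf _
    (Submodule.mem_iSup_of_mem j (mem_levelSpace w j k))

/-- Each level space is orthogonal to the differences of its own level, so a vector lying in all of
them is orthogonal to every difference. -/
lemma iInf_levelSpace (h : IsRefinable s₀ s₁ w) : ⨅ j, levelSpace w j = ⊥ := by
  rw [Submodule.eq_bot_iff]
  intro f hf
  rw [Submodule.mem_iInf] at hf
  refine h.eq_zero_of_inner_diff fun j k => ?_
  have h1 : levelSpace w j ≤ (Submodule.span ℂ {refineDiff s₀ s₁ w j k})ᗮ := by
    refine Submodule.topologicalClosure_minimal _ (Submodule.span_le.2 ?_)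
      (Submodule.isClosed_orthogonal _)
    rintro _ ⟨l, rfl⟩
    rw [SetLike.mem_coe, Submodule.mem_orthogonal_singleton_iff_inner_right, inner_eq_zero_symm]
    exact h.inner_diff_same j l k
  exact Submodule.mem_orthogonal_singleton_iff_inner_right.1 (h1 (hf j))

lemma orthonormal_zero (h : IsRefinable s₀ s₁ w) : Orthonormal ℂ (w 0) := by
  classical
  rw [orthonormal_iff_ite]
  intro k l
  split_ifs with hkl
  · rw [hkl, h.inner_self]; simp
  · exact h.inner_ne _ _ _ hkl

end IsRefinable

end Refinement

/-! ### Composition with an invertible matrix on `L₂` -/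

section Dilation

variable {d : ℕ}

lemma quasiMeasurePreserving_mulVec {A : Matrix (Fin d) (Fin d) ℝ} (hA : A.det ≠ 0) :
    Measure.QuasiMeasurePreserving (fun x => A.mulVec x)
      (volume : Measure (Fin d → ℝ)) volume := by
  refine ⟨(continuous_mulVec A).measurable, ?_⟩
  have h := Real.map_matrix_volume_pi_eq_smul_volume_pi hA
  change Measure.map (fun x => A.mulVec x) volume = _ at h
  rw [h]
  exact Measure.smul_absolutelyContinuous

/-- The composition operator `f ↦ f(A ·)` on `L₂`. -/
lemma exists_dilation {A : Matrix (Fin d) (Fin d) ℝ} (hA : A.det ≠ 0) :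
    ∃ L : L2 d →L[ℂ] L2 d, ∀ f : L2 d, L f =ᵐ[volume] fun x => f (A.mulVec x) := by
  have hq := quasiMeasurePreserving_mulVec hA
  have hmap : Measure.map (fun x => A.mulVec x) (volume : Measure (Fin d → ℝ))
      = ENNReal.ofReal |A.det⁻¹| • volume := Real.map_matrix_volume_pi_eq_smul_volume_pi hA
  have hmem : ∀ f : L2 d, MemLp (fun x => f (A.mulVec x)) 2 volume := fun f => by
    refine MemLp.comp_of_map (f := fun x => A.mulVec x) (g := f) ?_ hq.aemeasurable
    rw [hmap]
    exact (Lp.memLp f).smul_measure ENNReal.ofReal_ne_top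
  let L : L2 d →ₗ[ℂ] L2 d :=
    { toFun := fun f => (hmem f).toLp _
      map_add' := fun f g => by
        refine Lp.ext ?_
        filter_upwards [(hmem (f + g)).coeFn_toLp, Lp.coeFn_add ((hmem f).toLp _)
          ((hmem g).toLp _), (hmem f).coeFn_toLp, (hmem g).coeFn_toLp,
          hq.ae (Lp.coeFn_add f g)] with x h1 h2 h3 h4 h5
        rw [h1, h2, h5, Pi.add_apply, Pi.add_apply, h3, h4]
      map_smul' := fun c f => by
        refine Lp.ext ?_
        filter_upwards [(hmem (c • f)).coeFn_toLp, Lp.coeFn_smul c ((hmem f).toLp _),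
          (hmem f).coeFn_toLp, hq.ae (Lp.coeFn_smul c f)] with x h1 h2 h3 h4
        rw [RingHom.id_apply, h1, h2, h4, Pi.smul_apply, Pi.smul_apply, h3] }
  refine ⟨L.mkContinuous ((ENNReal.ofReal |A.det⁻¹|) ^ (1 / (2 : ENNReal)).toReal).toReal
    fun f => ?_, fun f => (hmem f).coeFn_toLp⟩
  change ‖(hmem f).toLp _‖ ≤ _
  rw [Lp.norm_toLp, Lp.norm_def, ← ENNReal.toReal_mul]
  have h1 : eLpNorm (fun x => f (A.mulVec x)) 2 volume
      = eLpNorm f 2 (Measure.map (fun x => A.mulVec x) volume) := by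
    rw [eLpNorm_map_measure _ hq.aemeasurable]
    · rfl
    · exact (Lp.aestronglyMeasurable f).mono_ac hq.absolutelyContinuous
  rw [h1, hmap, eLpNorm_smul_measure_of_ne_top ENNReal.ofNat_ne_top, smul_eq_mul]

end Dilation

/-! ### The cells `M^{-j}(G + k)`, the MRA and the Haar basis -/

section Cells

variable {d : ℕ} {M : Matrix (Fin d) (Fin d) ℤ} {e : Fin d → ℤ}

/-- The preimage of a set under the `j`-th power of the dilation. -/
def level (M : Matrix (Fin d) (Fin d) ℤ) (j : ℤ) (s : Set (Fin d → ℝ)) : Set (Fin d → ℝ) :=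
  {x | (toReal M ^ j).mulVec x ∈ s}

/-- The translate of the attractor by an integer vector. -/
def translate (M : Matrix (Fin d) (Fin d) ℤ) (e k : Fin d → ℤ) : Set (Fin d → ℝ) :=
  {x | x - vecReal k ∈ attractor M {0, e}}

namespace IsTernaryDigit

lemma zpow_mulVec (h : IsTernaryDigit M e) (j : ℤ) (x : Fin d → ℝ) :
    (toReal M ^ (j + 1)).mulVec x = (toReal M ^ j).mulVec ((toReal M).mulVec x) := by
  rw [Matrix.zpow_add_one (isUnit_det_toReal h.det_ne_zero), Matrix.mulVec_mulVec]

lemma zpow_mulVec' (h : IsTernaryDigit M e) (j : ℤ) (x : Fin d → ℝ) :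
    (toReal M ^ (j + 1)).mulVec x = (toReal M).mulVec ((toReal M ^ j).mulVec x) := by
  rw [add_comm, Matrix.zpow_add (isUnit_det_toReal h.det_ne_zero), zpow_one,
    Matrix.mulVec_mulVec]

lemma volume_level (h : IsTernaryDigit M e) (j : ℤ) (s : Set (Fin d → ℝ)) :
    volume (level M j s) = 2 ^ (-j) * volume s := by
  have hstep : ∀ j, 2 * volume (level M (j + 1) s) = volume (level M j s) := fun j => by
    rw [← h.volume_preimage (level M j s)]
    congr 2
    ext x
    exact iff_of_eq (congrArg (· ∈ s) (h.zpow_mulVec j x))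
  have h2 : ∀ a : ENNReal, (2 : ENNReal)⁻¹ * (2 * a) = a := fun a => by
    rw [← mul_assoc, ENNReal.inv_mul_cancel two_ne_zero ENNReal.ofNat_ne_top, one_mul]
  induction j with
  | zero => simp [level]
  | succ n ih =>
    rw [← h2 (volume (level M (n + 1) s)), hstep, ih, neg_add, ENNReal.zpow_add two_ne_zero
      ENNReal.ofNat_ne_top, ← mul_assoc, mul_comm (2⁻¹ : ENNReal), zpow_neg_one]
  | pred n ih =>
    have := hstep (-n - 1)
    rw [sub_add_cancel] at this
    rw [← this, ih, neg_sub, sub_eq_add_neg, ENNReal.zpow_add two_ne_zero ENNReal.ofNat_ne_top,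
      zpow_one, mul_assoc]

lemma measurableSet_level (j : ℤ) {s : Set (Fin d → ℝ)} (hs : MeasurableSet s) :
    MeasurableSet (level M j s) :=
  (continuous_mulVec _).measurable hs

lemma measurableSet_translate (h : IsTernaryDigit M e) (k : Fin d → ℤ) :
    MeasurableSet (translate M e k) :=
  h.isCompact.measurableSet.preimage (measurable_id.sub_const _)

lemma volume_translate_attractor (h : IsTernaryDigit M e) (k : Fin d → ℤ) :
    volume (translate M e k) = 1 :=
  (volume_translate _ _).trans h.volume_attractor

lemma measurableSet_cell (h : IsTernaryDigit M e) (j : ℤ) (k : Fin d → ℤ) :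
    MeasurableSet (level M j (translate M e k)) :=
  measurableSet_level j (h.measurableSet_translate k)

lemma volume_cell (h : IsTernaryDigit M e) (j : ℤ) (k : Fin d → ℤ) :
    volume (level M j (translate M e k)) = 2 ^ (-j) := by
  rw [h.volume_level, h.volume_translate_attractor, mul_one]

lemma volume_cell_ne_top (h : IsTernaryDigit M e) (j : ℤ) (k : Fin d → ℤ) :
    volume (level M j (translate M e k)) ≠ ⊤ := by
  rw [h.volume_cell]
  exact ENNReal.zpow_ne_top two_ne_zero ENNReal.ofNat_ne_top _

lemma volume_cell_inter (h : IsTernaryDigit M e) (j : ℤ) {k l : Fin d → ℤ} (hkl : k ≠ l) :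
    volume (level M j (translate M e k) ∩ level M j (translate M e l)) = 0 := by
  have : level M j (translate M e k) ∩ level M j (translate M e l)
      = level M j (translate M e k ∩ translate M e l) := rfl
  rw [this, h.volume_level, translate, translate, h.volume_inter_eq_zero hkl, mul_zero]

/-- A cell splits into two cells of the next level. -/
lemma mem_cell_iff (h : IsTernaryDigit M e) (j : ℤ) (k : Fin d → ℤ) (x : Fin d → ℝ) :
    x ∈ level M j (translate M e k) ↔ x ∈ level M (j + 1) (translate M e (M.mulVec k)) ∨
      x ∈ level M (j + 1) (translate M e (M.mulVec k + e)) := by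
  simp only [level, translate, Set.mem_ofPred_eq, h.zpow_mulVec', vecReal_add, ← sub_sub,
    ← toReal_mulVec, ← Matrix.mulVec_sub]
  exact h.mem_iff _

lemma exists_mem_cell (h : IsTernaryDigit M e) (j : ℤ) (x : Fin d → ℝ) :
    ∃ k, x ∈ level M j (translate M e k) :=
  h.exists_sub_mem _

/-- The diameters of the cells tend to zero. -/
lemma exists_dist_bound (h : IsTernaryDigit M e) :
    ∃ δ : ℕ → ℝ, Filter.Tendsto δ Filter.atTop (nhds 0) ∧
      ∀ (n : ℕ) k x y, x ∈ level M n (translate M e k) → y ∈ level M n (translate M e k) →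
        dist x y ≤ δ n := by
  obtain ⟨c, hc, hcb⟩ := exists_bound_inv_pow_mulVec h.dim_pos h.expanding h.det_ne_zero
  obtain ⟨R, hR⟩ := Metric.isBounded_iff.1 h.isCompact.isBounded
  refine ⟨fun n => |c n| * R, ?_, fun n k x y hx hy => ?_⟩
  · simpa using hc.abs.tendsto_atTop_zero.mul_const R
  · have h1 := hR hx hy
    have hu := isUnit_det_toReal h.det_ne_zero
    rw [dist_sub_right, dist_eq_norm, ← Matrix.mulVec_sub, zpow_natCast] at h1
    have h2 : x - y = ((toReal M)⁻¹ ^ n).mulVec (((toReal M) ^ n).mulVec (x - y)) := by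
      rw [Matrix.mulVec_mulVec, Matrix.inv_pow', Matrix.nonsing_inv_mul, Matrix.one_mulVec]
      rw [Matrix.det_pow]; exact hu.pow n
    rw [dist_eq_norm, h2]
    exact (hcb _ _).trans (mul_le_mul (le_abs_self _) h1 (norm_nonneg _) (abs_nonneg _))

/-- A locally integrable function whose integrals over all cells vanish is zero. -/
lemma ae_eq_zero_of_cells (h : IsTernaryDigit M e) {f : (Fin d → ℝ) → ℂ}
    (hf : LocallyIntegrable f volume)
    (hcell : ∀ (j : ℤ) k, ∫ x in level M j (translate M e k), f x = 0) : f =ᵐ[volume] 0 := by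
  refine ae_eq_zero_of_forall_setIntegral_isCompact_eq_zero' hf fun K hK => ?_
  rcases K.eq_empty_or_nonempty with rfl | hKne
  · simp
  obtain ⟨δ, hδ, hdist⟩ := h.exists_dist_bound
  obtain ⟨B, hB⟩ := hδ.bddAbove_range
  -- `E n` is the union of the level-`n` cells that meet `K`. As the cells shrink, the sets `E n`
  -- stay in one compact thickening and their indicators converge pointwise to that of `K`.
  let I : ℕ → Set (Fin d → ℤ) := fun n => {k | (level M n (translate M e k) ∩ K).Nonempty}
  let E : ℕ → Set (Fin d → ℝ) := fun n => ⋃ k : I n, level M n (translate M e k)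
  have hEm : ∀ n, MeasurableSet (E n) := fun n =>
    MeasurableSet.iUnion fun k => h.measurableSet_cell n k
  have hEδ : ∀ n, E n ⊆ Metric.cthickening (δ n) K := by
    intro n x hx
    obtain ⟨⟨k, y, hy, hyK⟩, hxk⟩ := Set.mem_iUnion.1 hx
    exact Metric.mem_cthickening_of_dist_le x y _ _ hyK (hdist n k x y hxk hy)
  have hEB : ∀ n, E n ⊆ Metric.cthickening B K := fun n =>
    (hEδ n).trans (Metric.cthickening_mono (hB ⟨n, rfl⟩) K)
  have hKE : ∀ n, K ⊆ E n := by
    intro n x hx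
    obtain ⟨k, hk⟩ := h.exists_mem_cell n x
    exact Set.mem_iUnion.2 ⟨⟨k, x, hk, hx⟩, hk⟩
  have hfW : IntegrableOn f (Metric.cthickening B K) :=
    hf.integrableOn_isCompact hK.cthickening
  -- `E n` is a countable union of almost disjoint cells, each with vanishing integral.
  have hE0 : ∀ n, ∫ x in E n, f x = 0 := by
    intro n
    have hs := hasSum_integral_iUnion_ae (μ := volume) (f := f)
      (s := fun k : I n => level M n (translate M e k))
      (fun k => (h.measurableSet_cell n k).nullMeasurableSet)
      (fun k l hkl => h.volume_cell_inter n fun hkl' => hkl (Subtype.ext hkl'))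
      (hfW.mono_set (hEB n))
    simp only [hcell] at hs
    exact hs.unique hasSum_zero
  have hlim : Filter.Tendsto (fun n => ∫ x, (E n).indicator f x) Filter.atTop
      (nhds (∫ x, K.indicator f x)) := by
    refine tendsto_integral_of_dominated_convergence
      ((Metric.cthickening B K).indicator fun x => ‖f x‖) (fun n => ?_) ?_ (fun n => ?_) ?_
    · exact hf.aestronglyMeasurable.indicator (hEm n)
    · exact (integrable_indicator_iff Metric.isClosed_cthickening.measurableSet).2 hfW.norm
    · refine Filter.Eventually.of_forall fun x => ?_
      rw [norm_indicator_eq_indicator_norm]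
      exact Set.indicator_le_indicator_of_subset (hEB n) (fun _ => norm_nonneg _) x
    · refine Filter.Eventually.of_forall fun x => ?_
      by_cases hx : x ∈ K
      · simp only [Set.indicator_of_mem hx, Set.indicator_of_mem (hKE _ hx)]
        exact tendsto_const_nhds
      · rw [Set.indicator_of_notMem hx]
        have hpos := (hK.isClosed.notMem_iff_infDist_pos hKne).1 hx
        refine Filter.Tendsto.congr' ?_ tendsto_const_nhds
        filter_upwards [hδ.eventually_lt_const hpos] with n hn
        rw [Set.indicator_of_notMem]
        intro hxE
        obtain ⟨⟨k, y, hy, hyK⟩, hxk⟩ := Set.mem_iUnion.1 hxE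
        exact absurd ((Metric.infDist_le_dist_of_mem hyK).trans (hdist n k x y hxk hy))
          (not_le.2 hn)
  simp only [integral_indicator (hEm _), hE0, integral_indicator hK.measurableSet] at hlim
  exact tendsto_nhds_unique hlim tendsto_const_nhds

/-- The characteristic functions of the cells, as elements of `L₂`. -/
def cellLp (h : IsTernaryDigit M e) (j : ℤ) (k : Fin d → ℤ) : L2 d :=
  indicatorConstLp 2 (h.measurableSet_cell j k) (h.volume_cell_ne_top j k) 1

lemma cellLp_ae (h : IsTernaryDigit M e) (j : ℤ) (k : Fin d → ℤ) :
    h.cellLp j k =ᵐ[volume] fun x =>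
      chi (attractor M {0, e}) ((toReal M ^ j).mulVec x - vecReal k) :=
  indicatorConstLp_coeFn

lemma cellLp_split (h : IsTernaryDigit M e) (j : ℤ) (k : Fin d → ℤ) :
    h.cellLp j k = h.cellLp (j + 1) (M.mulVec k) + h.cellLp (j + 1) (M.mulVec k + e) := by
  have hne : M.mulVec k ≠ M.mulVec k + e := by simpa using h.ne_zero
  have hnull := measure_eq_zero_iff_ae_notMem.1 (h.volume_cell_inter (j + 1) hne)
  refine Lp.ext ?_
  filter_upwards [h.cellLp_ae j k, h.cellLp_ae (j + 1) (M.mulVec k),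
    h.cellLp_ae (j + 1) (M.mulVec k + e), Lp.coeFn_add (h.cellLp (j + 1) (M.mulVec k))
    (h.cellLp (j + 1) (M.mulVec k + e)), hnull] with x h1 h2 h3 h4 h5
  rw [h4, Pi.add_apply, h1, h2, h3]
  have h6 := h.mem_cell_iff j k x
  simp only [level, translate, Set.mem_ofPred_eq, Set.mem_inter_iff] at h5 h6
  unfold chi
  by_cases ha : (toReal M ^ (j + 1)).mulVec x - vecReal (M.mulVec k) ∈ attractor M {0, e}
  · have hb : (toReal M ^ (j + 1)).mulVec x - vecReal (M.mulVec k + e) ∉ attractor M {0, e} :=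
      fun hb => h5 ⟨ha, hb⟩
    rw [Set.indicator_of_mem (h6.2 (Or.inl ha)), Set.indicator_of_mem ha,
      Set.indicator_of_notMem hb, add_zero]
  · by_cases hb : (toReal M ^ (j + 1)).mulVec x - vecReal (M.mulVec k + e) ∈ attractor M {0, e}
    · rw [Set.indicator_of_mem (h6.2 (Or.inr hb)), Set.indicator_of_notMem ha,
        Set.indicator_of_mem hb, zero_add]
    · rw [Set.indicator_of_notMem (fun hc => (h6.1 hc).elim ha hb), Set.indicator_of_notMem ha,
        Set.indicator_of_notMem hb, zero_add]

lemma mulVec_injective (h : IsTernaryDigit M e) : Function.Injective fun k => M.mulVec k :=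
  Matrix.mulVec_injective_of_det_ne_zero h.det_ne_zero

lemma isRefinable (h : IsTernaryDigit M e) :
    IsRefinable (fun k => M.mulVec k) (fun k => M.mulVec k + e) h.cellLp where
  inj₀ := h.mulVec_injective
  inj₁ := fun k l hkl => h.mulVec_injective (add_right_cancel hkl)
  ne := fun k l hkl => h.not_mem (k - l) (by rw [Matrix.mulVec_sub, hkl, add_sub_cancel_left])
  surj := h.exists_residue
  inner_ne := fun j k l hkl => by
    rw [cellLp, cellLp, L2.inner_indicatorConstLp_one_indicatorConstLp_one _ _
      (h.volume_cell_ne_top j k) (h.volume_cell_ne_top j l), measureReal_def,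
      h.volume_cell_inter j hkl]
    simp
  inner_self := fun j k => by
    rw [cellLp, L2.inner_indicatorConstLp_one_indicatorConstLp_one _ _
      (h.volume_cell_ne_top j k) (h.volume_cell_ne_top j k), Set.inter_self,
      measureReal_def, h.volume_cell, show (2 : ENNReal) = ((2 : NNReal) : ENNReal) from rfl,
      ← ENNReal.coe_zpow two_ne_zero, ENNReal.coe_toReal]
    push_cast
    rfl
  split := h.cellLp_split
  total := fun f hf => by
    refine (Lp.eq_zero_iff_ae_eq_zero).2 (h.ae_eq_zero_of_cells
      ((Lp.memLp f).locallyIntegrable one_le_two) fun j k => ?_)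
    rw [← hf j k, cellLp, L2.inner_indicatorConstLp_one]

lemma generatesMRA (h : IsTernaryDigit M e) :
    GeneratesMRA (toReal M) (chi (attractor M {0, e})) := by
  have hu := isUnit_det_toReal h.det_ne_zero
  have hr := h.isRefinable
  refine ⟨levelSpace h.cellLp, IsRefinable.isClosed_levelSpace _, hr.levelSpace_le,
    ?_, hr.iSup_levelSpace, hr.iInf_levelSpace, h.cellLp 0, fun k => ?_, hr.orthonormal_zero, rfl⟩
  · intro j f g hfg
    have hq := quasiMeasurePreserving_mulVec hu.ne_zero
    have hu' : (toReal M)⁻¹.det ≠ 0 := (Matrix.isUnit_nonsing_inv_det _ hu).ne_zero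
    have hq' := quasiMeasurePreserving_mulVec hu'
    obtain ⟨L, hL⟩ := exists_dilation hu.ne_zero
    obtain ⟨L', hL'⟩ := exists_dilation hu'
    have hLf : L f = g := Lp.ext ((hL f).trans hfg.symm)
    have hLg : L' g = f := by
      refine Lp.ext ((hL' g).trans ?_)
      filter_upwards [hq'.ae hfg] with x hx
      rw [hx, Matrix.mulVec_mulVec, Matrix.mul_nonsing_inv _ hu, Matrix.one_mulVec]
    have hcell : ∀ k, L (h.cellLp j k) = h.cellLp (j + 1) k := fun k => by
      refine Lp.ext ((hL _).trans ?_)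
      filter_upwards [hq.ae (h.cellLp_ae j k), h.cellLp_ae (j + 1) k] with x h1 h2
      rw [h1, h2, h.zpow_mulVec]
    have hcell' : ∀ k, L' (h.cellLp (j + 1) k) = h.cellLp j k := fun k => by
      refine Lp.ext ((hL' _).trans ?_)
      filter_upwards [hq'.ae (h.cellLp_ae (j + 1) k), h.cellLp_ae j k] with x h1 h2
      rw [h1, h2, h.zpow_mulVec, Matrix.mulVec_mulVec x, Matrix.mul_nonsing_inv _ hu,
        Matrix.one_mulVec]
    -- A continuous operator that permutes cells between levels maps closed span into closed span;
    -- it is applied to the dilation and to its inverse.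
    have hmap : ∀ (i i' : ℤ) (S : L2 d →L[ℂ] L2 d),
        (∀ k, S (h.cellLp i k) = h.cellLp i' k) → ∀ f ∈ levelSpace h.cellLp i,
          S f ∈ levelSpace h.cellLp i' := by
      intro i i' S hS
      have : levelSpace h.cellLp i ≤ (levelSpace h.cellLp i').comap S.toLinearMap := by
        refine Submodule.topologicalClosure_minimal _ (Submodule.span_le.2 ?_)
          ((IsRefinable.isClosed_levelSpace h.cellLp i').preimage S.continuous)
        rintro _ ⟨k, rfl⟩
        change S _ ∈ levelSpace _ _
        rw [hS]
        exact IsRefinable.mem_levelSpace _ _ _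
      exact this
    constructor
    · intro hf; rw [← hLf]; exact hmap _ _ L hcell f hf
    · intro hg; rw [← hLg]; exact hmap _ _ L' hcell' g hg
  · refine (h.cellLp_ae 0 k).trans (Filter.Eventually.of_forall fun x => ?_)
    simp only [zpow_zero, Matrix.one_mulVec]

/-- By `M^{j+1} x - M k = M (M^j x - k)`, the difference of the halves of a cell is a dilated and
shifted Haar function. -/
lemma generatesWaveletBasis (h : IsTernaryDigit M e) :
    GeneratesWaveletBasis (toReal M) (haar M e) := by
  obtain ⟨b, hb⟩ := h.isRefinable.exists_hilbertBasis
  refine ⟨b, fun j k => ?_⟩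
  have hdet : |(toReal M).det| = 2 := by
    rw [det_toReal, ← Int.cast_abs, Int.abs_eq_natAbs, h.det_natAbs]; norm_num
  rw [hb, hdet, refineDiff]
  filter_upwards [Lp.coeFn_smul ((((Real.sqrt 2) ^ j : ℝ) : ℂ))
      (h.cellLp (j + 1) (M.mulVec k) - h.cellLp (j + 1) (M.mulVec k + e)),
    Lp.coeFn_sub (h.cellLp (j + 1) (M.mulVec k)) (h.cellLp (j + 1) (M.mulVec k + e)),
    h.cellLp_ae (j + 1) (M.mulVec k), h.cellLp_ae (j + 1) (M.mulVec k + e)] with x h1 h2 h3 h4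
  rw [h1, Pi.smul_apply, h2, Pi.sub_apply, h3, h4, smul_eq_mul, haar, Matrix.mulVec_sub,
    toReal_mulVec, h.zpow_mulVec', vecReal_add, sub_sub]

end IsTernaryDigit

end Cells

/-! ### Reduction of an isotropic matrix to the companion matrix -/

section Conjugation

open scoped ComplexOrder

variable {d : ℕ}

/-- All eigenvalues of a multiple of an orthogonal matrix have the same modulus. -/
lemma IsotropicMatrix.isotropicPoly {N : Matrix (Fin d) (Fin d) ℤ} (hN : IsotropicMatrix N) :
    IsotropicPoly N.charpoly := by
  obtain ⟨c, P, Q, hP, hQ, hNPQ⟩ := hN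
  suffices h : ∀ z : ℂ, aeval z N.charpoly = 0 → ‖z‖ ^ 2 = c ^ 2 by
    intro z w hz hw
    have := (h z hz).trans (h w hw).symm
    exact (pow_left_inj₀ (norm_nonneg _) (norm_nonneg _) two_ne_zero).1 this
  intro z hz
  let φ := (Complex.ofRealHom).mapMatrix (m := Fin d)
  have hchar : aeval z (c • Q).charpoly = 0 := by
    have h1 : (toReal N).charpoly = (c • Q).charpoly := by
      obtain ⟨u, rfl⟩ := hP
      rw [hNPQ, Matrix.charpoly_units_conj]
    rw [← h1, toReal_eq_map, RingHom.mapMatrix_apply, Matrix.charpoly_map]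
    rw [aeval_def, eval₂_map]
    rw [aeval_def] at hz
    convert hz
    exact Subsingleton.elim _ _
  have hspec : z ∈ spectrum ℂ (φ (c • Q)) := by
    rw [Matrix.mem_spectrum_iff_isRoot_charpoly, RingHom.mapMatrix_apply, Matrix.charpoly_map,
      IsRoot.def, eval_map]
    exact hchar
  rw [← Matrix.spectrum_toLin', ← Module.End.hasEigenvalue_iff_mem_spectrum] at hspec
  obtain ⟨v, hv⟩ := hspec.exists_hasEigenvector
  have hv1 : (φ (c • Q)).mulVec v = z • v := by simpa using hv.apply_eq_smul
  -- For `A = c Q` one has `A* A = c²`, so an eigenvector `v` gives `|z|² |v|² = |A v|² = c² |v|²`.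
  have hQQ : (φ (c • Q)).conjTranspose * φ (c • Q) = ((c : ℂ) ^ 2) • 1 := by
    have h1 : (φ (c • Q)).conjTranspose = φ (c • Q).transpose := by
      ext i j; simp [φ]
    have h2 : (c • Q).transpose * (c • Q) = (c ^ 2) • 1 := by
      have h3 : Q.transpose * Q = 1 := by
        have := (Matrix.mem_orthogonalGroup_iff' (Fin d) ℝ).1 hQ
        simpa [Matrix.star_eq_conjTranspose] using this
      rw [Matrix.transpose_smul, Matrix.smul_mul, Matrix.mul_smul, smul_smul, h3, sq]
    rw [h1, ← map_mul, h2]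
    ext i j
    simp only [φ, RingHom.mapMatrix_apply, Matrix.map_apply, Matrix.smul_apply, Matrix.one_apply]
    split_ifs <;> simp
  have h1 : dotProduct (star ((φ (c • Q)).mulVec v)) ((φ (c • Q)).mulVec v)
      = (c : ℂ) ^ 2 * dotProduct (star v) v := by
    rw [Matrix.star_mulVec, ← Matrix.dotProduct_mulVec, Matrix.mulVec_mulVec, hQQ,
      Matrix.smul_mulVec, Matrix.one_mulVec, dotProduct_smul, smul_eq_mul]
  rw [hv1, star_smul, smul_dotProduct, dotProduct_smul, smul_eq_mul, smul_eq_mul, ← mul_assoc]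
    at h1
  have hne : dotProduct (star v) v ≠ 0 := fun h => hv.2 (dotProduct_star_self_eq_zero.1 h)
  have h2 := mul_right_cancel₀ hne h1
  rw [mul_comm, Complex.star_def, Complex.mul_conj, Complex.normSq_eq_norm_sq] at h2
  exact_mod_cast h2

variable {N : Matrix (Fin d) (Fin d) ℤ}

/-- The matrix with columns `v, N v, …, N^(d-1) v`. -/
def krylov (N : Matrix (Fin d) (Fin d) ℤ) (v : Fin d → ℤ) : Matrix (Fin d) (Fin d) ℤ :=
  Matrix.of fun i j => ((N ^ (j : ℕ)).mulVec v) i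

lemma krylov_mulVec_single (v : Fin d → ℤ) (j : Fin d) :
    (krylov N v).mulVec (Pi.single j 1) = (N ^ (j : ℕ)).mulVec v := by
  rw [Matrix.mulVec_single_one]; rfl

/-- Reduction modulo the characteristic polynomial changes neither side, and in degree below `d` the
columns of the Krylov matrix give the claim. The matrix is thus the `ℤ[X]`-linear map sending `e₁`
to `v`. -/
lemma krylov_mulVec (v : Fin d → ℤ) (f : ℤ[X]) :
    (krylov N v).mulVec ((aeval (companion d N.charpoly) f).mulVec (e₁ d))
      = (aeval N f).mulVec v := by
  rcases Nat.eq_zero_or_pos d with rfl | hd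
  · exact Subsingleton.elim _ _
  have hm := Matrix.charpoly_monic N
  have hdeg : N.charpoly.natDegree = d := by
    rw [Matrix.charpoly_natDegree_eq_dim, Fintype.card_fin]
  have hlow : ∀ g : ℤ[X], g.natDegree < d →
      (krylov N v).mulVec ((aeval (companion d N.charpoly) g).mulVec (e₁ d))
        = (aeval N g).mulVec v := fun g hg => by
    rw [aeval_eq_sum_range' hg, aeval_eq_sum_range' hg, Matrix.sum_mulVec, Matrix.sum_mulVec,
      Finset.sum_range, Finset.sum_range, Matrix.mulVec_sum]
    refine Finset.sum_congr rfl fun i _ => ?_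
    rw [Matrix.smul_mulVec, Matrix.smul_mulVec, companion_pow_mulVec i.is_lt,
      Matrix.mulVec_smul, krylov_mulVec_single]
  have h1 : aeval (companion d N.charpoly) f
      = aeval (companion d N.charpoly) (f %ₘ N.charpoly) := by
    conv_lhs => rw [← modByMonic_add_div f N.charpoly]
    rw [map_add, map_mul, aeval_companion hm hdeg hd, zero_mul, add_zero]
  have h2 : aeval N f = aeval N (f %ₘ N.charpoly) := by
    conv_lhs => rw [← modByMonic_add_div f N.charpoly]
    rw [map_add, map_mul, Matrix.aeval_self_charpoly, zero_mul, add_zero]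
  rw [h1, h2]
  refine hlow _ ((natDegree_modByMonic_lt f hm ?_).trans_eq hdeg)
  intro h
  rw [h] at hdeg
  simp at hdeg
  omega

lemma krylov_mul_companion (v : Fin d → ℤ) :
    krylov N v * companion d N.charpoly = N * krylov N v := by
  refine Matrix.ext_of_mulVec_single fun i => ?_
  obtain ⟨f, hf⟩ := exists_aeval_companion_mulVec (p := N.charpoly) (Pi.single i (1 : ℤ))
  have hX : ∀ (A : Matrix (Fin d) (Fin d) ℤ) (w : Fin d → ℤ),
      A.mulVec ((aeval A f).mulVec w) = (aeval A (X * f)).mulVec w := fun A w => by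
    rw [map_mul, aeval_X, Matrix.mulVec_mulVec]
  rw [← hf, ← Matrix.mulVec_mulVec, ← Matrix.mulVec_mulVec, krylov_mulVec, hX, hX, krylov_mulVec]

lemma krylov_mulVec_e₁ (v : Fin d → ℤ) : (krylov N v).mulVec (e₁ d) = v := by
  simpa using krylov_mulVec (N := N) v 1

/-- Every nonzero vector is cyclic for a matrix with irreducible characteristic polynomial. -/
lemma det_krylov_ne_zero (hirr : Irreducible N.charpoly) {v : Fin d → ℤ} (hv : v ≠ 0) :
    (krylov N v).det ≠ 0 := by
  intro hdet
  obtain ⟨u, hu, hKu⟩ := Matrix.exists_mulVec_eq_zero_iff.2 hdet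
  obtain ⟨f, rfl⟩ := exists_aeval_companion_mulVec (p := N.charpoly) u
  rw [krylov_mulVec] at hKu
  have hd : 0 < d := by
    rcases Nat.eq_zero_or_pos d with rfl | hd
    · exact absurd (Subsingleton.elim _ _) hv
    · exact hd
  have hm := Matrix.charpoly_monic N
  have hdeg : N.charpoly.natDegree = d := by
    rw [Matrix.charpoly_natDegree_eq_dim, Fintype.card_fin]
  have hnd : ¬ N.charpoly ∣ f := by
    rintro ⟨g, rfl⟩
    apply hu
    rw [map_mul, aeval_companion hm hdeg hd, zero_mul, Matrix.zero_mulVec]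
  let ι := algebraMap ℤ ℚ
  have hirrQ : Irreducible (N.charpoly.map ι) :=
    (hm.irreducible_iff_irreducible_map_fraction_map (K := ℚ)).1 hirr
  -- A relation `f(N) v = 0` with `f` prime to the characteristic polynomial gives `v = 0` by Bézout
  -- over `ℚ` and Cayley-Hamilton.
  have hcop : IsCoprime (N.charpoly.map ι) (f.map ι) := by
    rw [hirrQ.coprime_iff_not_dvd]
    intro h
    exact hnd ((map_dvd_map ι (algebraMap ℤ ℚ).injective_int hm).1 h)
  obtain ⟨A, B, hAB⟩ := hcop
  let NQ : Matrix (Fin d) (Fin d) ℚ := ι.mapMatrix N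
  let vQ : Fin d → ℚ := fun i => ι (v i)
  have haev : ∀ g : ℤ[X], aeval NQ (g.map ι) = ι.mapMatrix (aeval N g) := fun g => by
    rw [aeval_map_algebraMap]
    exact (aeval_algHom_apply (ι.mapMatrix.toIntAlgHom) N g)
  have hvec : ∀ T : Matrix (Fin d) (Fin d) ℤ, (ι.mapMatrix T).mulVec vQ
      = fun i => ι (T.mulVec v i) := fun T => by
    ext i
    simp [vQ, Matrix.mulVec, dotProduct]
  have h1 := congrArg (fun g => (aeval NQ g).mulVec vQ) hAB
  simp only [map_add, map_mul, map_one, haev, Matrix.add_mulVec, ← Matrix.mulVec_mulVec, hvec,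
    hKu, Matrix.aeval_self_charpoly, Matrix.zero_mulVec, Matrix.one_mulVec] at h1
  apply hv
  ext i
  have h2 := congrFun h1 i
  have h3 : vQ i = 0 := by
    rw [← h2]
    have h0 : (fun i : Fin d => ι ((0 : Fin d → ℤ) i)) = 0 := by ext; simp
    rw [h0]; simp
  simpa [vQ, ι] using h3

/-- A two-digit attractor is an affine image of the attractor of the companion matrix. -/
lemma affinelySimilar_companion {a b : Fin d → ℤ} (hd : 0 < d) (hN : ExpandingMatrix N)
    (hdet : N.det ≠ 0) (hirr : Irreducible N.charpoly) (hab : a ≠ b)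
    (hM : (companion d N.charpoly).det ≠ 0) :
    AffinelySimilar (attractor N {a, b}) (attractor (companion d N.charpoly) {0, e₁ d}) := by
  set M := companion d N.charpoly with hMdef
  set K := krylov N (b - a) with hK
  have hKdet : K.det ≠ 0 := det_krylov_ne_zero hirr (sub_ne_zero.2 hab.symm)
  have huK := isUnit_det_toReal hKdet
  have huN := isUnit_det_toReal hdet
  have huM := isUnit_det_toReal hM
  have hcomm : toReal K * toReal M = toReal N * toReal K := by
    simp only [toReal_eq_map, ← map_mul]
    rw [hK, hMdef, krylov_mul_companion]
  have hinv : toReal K * (toReal M)⁻¹ = (toReal N)⁻¹ * toReal K := by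
    have h1 := congrArg (fun A => (toReal N)⁻¹ * A * (toReal M)⁻¹) hcomm
    simp only [← mul_assoc, Matrix.nonsing_inv_mul _ huN, one_mul] at h1
    rw [mul_assoc, mul_assoc, Matrix.mul_nonsing_inv _ huM, mul_one] at h1
    exact h1.symm
  have hpow : ∀ n : ℕ, toReal K * (toReal M)⁻¹ ^ n = (toReal N)⁻¹ ^ n * toReal K :=
    fun n => SemiconjBy.pow_right hinv n
  have hvec : (toReal K).mulVec (vecReal (e₁ d)) = vecReal b - vecReal a := by
    rw [toReal_mulVec, hK, krylov_mulVec_e₁, vecReal_sub]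
  have hsum := summable_attractor (D := {a}) hd hN hdet (a := fun _ => a) fun _ => by simp
  -- Subtracting `a` from every digit translates the attractor by `s = ∑ N^{-k} a` and leaves the
  -- digits `0` and `b - a = K e₁`.
  set s := ∑' k : ℕ, ((toReal N)⁻¹ ^ (k + 1)).mulVec (vecReal a) with hs
  have hdig : ∀ (n : ℕ) (c : Prop) [Decidable c],
      ((toReal N)⁻¹ ^ n).mulVec (vecReal (if c then b else a))
        = (toReal K).mulVec (((toReal M)⁻¹ ^ n).mulVec (vecReal (if c then e₁ d else 0)))
          + ((toReal N)⁻¹ ^ n).mulVec (vecReal a) := by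
    intro n c _
    rw [Matrix.mulVec_mulVec, hpow, ← Matrix.mulVec_mulVec, ← Matrix.mulVec_add]
    split_ifs
    · rw [hvec, sub_add_cancel]
    · rw [vecReal_zero, Matrix.mulVec_zero, zero_add]
  have hKinv : ∀ x, (toReal K)⁻¹.mulVec ((toReal K).mulVec x) = x := fun x => by
    rw [Matrix.mulVec_mulVec, Matrix.nonsing_inv_mul _ huK, Matrix.one_mulVec]
  have hKinv' : ∀ x, (toReal K).mulVec ((toReal K)⁻¹.mulVec x) = x := fun x => by
    rw [Matrix.mulVec_mulVec, Matrix.mul_nonsing_inv _ huK, Matrix.one_mulVec]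
  let Llin : (Fin d → ℝ) ≃ₗ[ℝ] (Fin d → ℝ) :=
    LinearEquiv.ofLinearMap (toReal K)⁻¹.mulVecLin (toReal K).mulVecLin
      (LinearMap.ext fun x => hKinv x) (LinearMap.ext fun x => hKinv' x)
  let E : (Fin d → ℝ) ≃ᵃ[ℝ] (Fin d → ℝ) :=
    (AffineEquiv.constVAdd ℝ (Fin d → ℝ) (-s)).trans Llin.toAffineEquiv
  have hE : ∀ x, E x = (toReal K)⁻¹.mulVec (x - s) := fun x => by
    change (toReal K)⁻¹.mulVec (-s + x) = _
    rw [neg_add_eq_sub]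
  refine ⟨E, Set.Subset.antisymm ?_ ?_⟩
  · rintro _ ⟨x, ⟨c, hc, hx⟩, rfl⟩
    classical
    refine ⟨fun k => if c k = b then e₁ d else 0, fun k => ?_, ?_⟩
    · dsimp only
      split_ifs <;> simp
    · rw [hE]
      have h1 := (hx.sub hsum.hasSum).map (toReal K)⁻¹.mulVecLin (continuous_mulVec (toReal K)⁻¹)
      refine h1.congr_fun fun k => ?_
      have hck : c k = if c k = b then b else a := by
        have := hc k
        simp only [Finset.mem_insert, Finset.mem_singleton] at this
        split_ifs with h
        · exact h
        · exact this.resolve_right h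
      simp only [Function.comp, Matrix.mulVecLin_apply]
      have h2 := hdig (k + 1) (c k = b)
      rw [← hck] at h2
      rw [h2, add_sub_cancel_right, hKinv]
  · rintro y ⟨c, hc, hy⟩
    classical
    refine ⟨(toReal K).mulVec y + s, ⟨fun k => if c k = e₁ d then b else a, fun k => ?_, ?_⟩, ?_⟩
    · dsimp only
      split_ifs <;> simp
    · have h1 := (hy.map (toReal K).mulVecLin (continuous_mulVec (toReal K))).add hsum.hasSum
      refine h1.congr_fun fun k => ?_
      have hck : c k = if c k = e₁ d then e₁ d else 0 := by
        have := hc k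
        simp only [Finset.mem_insert, Finset.mem_singleton] at this
        split_ifs with h
        · exact h
        · exact this.resolve_right h
      simp only [Function.comp, Matrix.mulVecLin_apply]
      rw [hdig, ← hck]
    · rw [hE, add_sub_cancel_right, hKinv]

end Conjugation

end TwoAttractor

end

theorem mainTheorem9 (d : ℕ) :
    (∀ p : ℤ[X], p.Monic → p.natDegree = d → (p.coeff 0 = 2 ∨ p.coeff 0 = -2) →
      TwoAttractor.ExpandingPoly p → TwoAttractor.IsotropicPoly p →
      TwoAttractor.GeneratesTwoTile (TwoAttractor.companion d p) {0, TwoAttractor.e₁ d} ∧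
      TwoAttractor.GeneratesMRA (TwoAttractor.toReal (TwoAttractor.companion d p))
        (TwoAttractor.chi (TwoAttractor.attractor (TwoAttractor.companion d p)
          {0, TwoAttractor.e₁ d})) ∧
      TwoAttractor.GeneratesWaveletBasis (TwoAttractor.toReal (TwoAttractor.companion d p))
        (TwoAttractor.haar (TwoAttractor.companion d p) (TwoAttractor.e₁ d))) ∧
    (∀ (N : Matrix (Fin d) (Fin d) ℤ) (D : Finset (Fin d → ℤ)),
      TwoAttractor.GeneratesTwoAttractor N D → TwoAttractor.IsotropicMatrix N →
      ∃ M : Matrix (Fin d) (Fin d) ℤ, M = TwoAttractor.companion d N.charpoly ∧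
        TwoAttractor.GeneratesTwoTile M {0, TwoAttractor.e₁ d} ∧
        TwoAttractor.AffinelySimilar (TwoAttractor.attractor N D)
          (TwoAttractor.attractor M {0, TwoAttractor.e₁ d}) ∧
        TwoAttractor.GeneratesMRA (TwoAttractor.toReal M)
          (TwoAttractor.chi (TwoAttractor.attractor M {0, TwoAttractor.e₁ d})) ∧
        TwoAttractor.GeneratesWaveletBasis (TwoAttractor.toReal M)
          (TwoAttractor.haar M (TwoAttractor.e₁ d))) := by
  refine ⟨fun p hp hpd h0 he hiso => ?_, fun N D hND hiso => ?_⟩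
  · have h := TwoAttractor.isTernaryDigit_companion hp hpd he h0 hiso
    exact ⟨h.generatesTwoTile, h.generatesMRA, h.generatesWaveletBasis⟩
  · obtain ⟨hsys, hdet⟩ := hND
    have hm := Matrix.charpoly_monic N
    have hdeg : N.charpoly.natDegree = d := by
      rw [Matrix.charpoly_natDegree_eq_dim, Fintype.card_fin]
    have he := (TwoAttractor.expandingMatrix_iff N).1 hsys.expanding
    have h0 : N.charpoly.coeff 0 = 2 ∨ N.charpoly.coeff 0 = -2 := by
      rw [TwoAttractor.det_natAbs_eq_charpoly_coeff_zero] at hdet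
      omega
    have h := TwoAttractor.isTernaryDigit_companion hm hdeg he h0 hiso.isotropicPoly
    refine ⟨_, rfl, h.generatesTwoTile, ?_, h.generatesMRA, h.generatesWaveletBasis⟩
    obtain ⟨a, b, hab, rfl⟩ := Finset.card_eq_two.1 (hsys.card_eq.trans hdet)
    exact TwoAttractor.affinelySimilar_companion h.dim_pos hsys.expanding
      (fun h => by rw [h] at hdet; simp at hdet)
      (TwoAttractor.ExpandingPoly.irreducible hm he h0) hab h.det_ne_zero
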